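/- Let $W:[0,1]^2\to\mathbb R_{\ge 0}$ be a measurable symmetric kernel that is irreducible, i.e. there is no measurable set $A\subseteq[0,1]$ with $0<\mu(A)<1$ and $\int_{A\times A^c}W(x,y)\,dx\,dy=0$ (where $\mu$ is Lebesgue measure). Put $H(x)=\int_{[0,1]}W(x,y)\,dy\in[0,\infty]$ and $\nu_0=\operatorname{ess\,inf}_{[0,1]}H$. Let $c\ge 0$ and $t_n=cn\log n$. For every $n\ge 2$ let $G_n=G_n(W,t)$ be the random multigraph with vertices $v_1,\dots,v_n$ obtained as follows: run a Poisson point process on $[0,1]^2$ with intensity $t_nW(x,y)\,dx\,dy$ and, with $S_i=((i-1)/n,i/n]$, for all $i\le j$ add one edge between $v_i$ and $v_j$ for every point of the process in $S_i\times S_j$ (a loop if $i=j$). With the conventions $1/0=\infty$ and $1/\infty=0$: (i) If $c<1/\nu_0$ and there is an open set $F\subseteq[0,1]$ with $\mu(F)=1$ and $H\in L^1_{\mathrm{loc}}(F)$, then $\lim_{n\to\infty}\mathbb P(G_n\text{ is connected})=0$. (ii) If $c>1/\nu_0$ and $W\in L^q([0,1]^2)$ for some $q>2$, then $\lim_{n\to\infty}\mathbb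 P(G_n\text{ is connected})=1$. -/

import Mathlib

open MeasureTheory ProbabilityTheory Filter Topology Set
open scoped ENNReal NNReal unitInterval

/-! ### Poisson point processes -/

/-- The Poisson distribution with parameter `r ∈ [0, ∞]`, as a law on `[0, ∞]`: it is carried by
the natural numbers if `r < ∞`, and it is the point mass at `∞` if `r = ∞`. -/
noncomputable def extPoissonLaw (r : ℝ≥0∞) : Measure ℝ≥0∞ :=
  if r = ⊤ then Measure.dirac ⊤
  else (poissonMeasure r.toNNReal).map (fun k : ℕ => (k : ℝ≥0∞))

/-- `N` is a Poisson point process with intensity measure `Λ` on the probability space `(Ω, P)`.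
The point configuration is described by its counting measure: `N ω B` is the number of points
in `B`. -/
structure IsPoissonPointProcess {Ω X : Type*} [MeasurableSpace Ω] [MeasurableSpace X]
    (N : Ω → Measure X) (Λ : Measure X) (P : Measure Ω) : Prop where
  /-- `N` is a random measure. -/
  measurable : Measurable N
  /-- The number of points in a measurable set is a natural number or infinite. -/
  integer_valued : ∀ ω, ∀ B : Set X, MeasurableSet B → ∃ k : ℕ∞, N ω B = (k : ℝ≥0∞)
  /-- The number of points in `B` has the Poisson distribution with parameter `Λ B`. -/
  hasLaw : ∀ B : Set X, MeasurableSet B → HasLaw (fun ω => N ω B) (extPoissonLaw (Λ B)) P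
  /-- The numbers of points in pairwise disjoint sets are independent. -/
  indep : ∀ {ι : Type} [Finite ι] (B : ι → Set X), (∀ i, MeasurableSet (B i)) →
    Pairwise (fun i j => Disjoint (B i) (B j)) → iIndepFun (fun i ω => N ω (B i)) P

/-! ### Kernels on the unit square -/

/-- The degree function `H(x) = ∫_{[0,1]} W(x,y) dy`. -/
noncomputable def kernelDegree (W : I → I → ℝ≥0) (x : I) : ℝ≥0∞ :=
  ∫⁻ y, (W x y : ℝ≥0∞)

/-- `ν₀`, the essential infimum over `[0,1]` of the degree function. -/
noncomputable def kernelMinDegree (W : I → I → ℝ≥0) : ℝ≥0∞ :=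
  essInf (kernelDegree W) volume

/-- `W` is irreducible: no set `A` with `0 < μ(A) < 1` satisfies `∫_{A × Aᶜ} W = 0`. -/
def KernelIrreducible (W : I → I → ℝ≥0) : Prop :=
  ¬ ∃ A : Set I, MeasurableSet A ∧ 0 < volume A ∧ volume A < 1 ∧
    ∫⁻ p in A ×ˢ Aᶜ, (W p.1 p.2 : ℝ≥0∞) = 0

/-- The measure `t W(x,y) dx dy` on the unit square. -/
noncomputable def kernelIntensity (t : ℝ) (W : I → I → ℝ≥0) : Measure (I × I) :=
  volume.withDensity fun p => ENNReal.ofReal t * (W p.1 p.2 : ℝ≥0∞)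

/-! ### The multigraph -/

/-- The `n` consecutive intervals `(i/n, (i+1)/n]`, `0 ≤ i < n`, in `[0,1]`. -/
def vertexInterval (n : ℕ) (i : Fin n) : Set I :=
  {x | (i : ℝ) / n < (x : ℝ) ∧ (x : ℝ) ≤ ((i : ℝ) + 1) / n}

/-- The multigraph of a point configuration with counting measure `m` on the unit square: for
`i ≤ j` there is one edge between `i` and `j` for every point in the product of the `i`-th and
the `j`-th interval. The edges between `i ≤ j` are labelled `(i, j, k)` with `k` running through
the natural numbers smaller than the number of points. -/
def pointMultigraph (n : ℕ) (m : Measure (I × I)) : Graph (Fin n) (Fin n × Fin n × ℕ) where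
  vertexSet := Set.univ
  IsLink e u v := e.1 ≤ e.2.1 ∧
    (e.2.2 : ℝ≥0∞) < m (vertexInterval n e.1 ×ˢ vertexInterval n e.2.1) ∧
    ((u = e.1 ∧ v = e.2.1) ∨ (u = e.2.1 ∧ v = e.1))
  isLink_symm := by
    intro e _
    exact ⟨fun u v h => ⟨h.1, h.2.1, h.2.2.symm.imp And.symm And.symm⟩⟩
  eq_or_eq_of_isLink_of_isLink := by
    rintro e x y v w ⟨-, -, h⟩ ⟨-, -, h'⟩
    grind
  left_mem_of_isLink := by
    intro e x y _
    exact Set.mem_univ x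

/-- A multigraph is connected if it has a vertex and any two of its vertices are joined by a
path. -/
def MultigraphConnected {α β : Type*} (G : Graph α β) : Prop :=
  G.vertexSet.Nonempty ∧
    ∀ u ∈ G.vertexSet, ∀ v ∈ G.vertexSet, Relation.ReflTransGen G.Adj u v

/-! ### Void probabilities -/

/-! The graph is disconnected exactly when some proper nonempty vertex set U has no point in its
crossing region. By symmetry of W this has probability exp(-t W(A × Aᶜ)) when the mass is finite,
where A is the union of the intervals of U and W(·) is the mass `kernelMass`.

Above the threshold a union bound over |U| ≤ n/2 suffices. For small A, the mass leaving A is at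
least ν₀|A| - W(A × A), and Hölder with q > 2 makes W(A × A) = o(|A|)
(`exists_kernelMass_compl_ge_of_small`). So U is cut off with probability at most n^{-(1+ε)|U|}, and
these sum to at most (1 + n^{-1-ε})^n - 1 → 0. For δ ≤ |A| ≤ 1/2, irreducibility and weak
compactness give a uniform bound W(A × Aᶜ) ≥ κ > 0 (`exists_kernelMass_compl_ge`), and exp(-cκ n log
n) beats the 2^n choices of U.

Below the threshold there are isolated vertices. Fix M > ν₀ with cM < 1. Lebesgue differentiation
yields at least δn vertices whose intervals carry degree mass at most M/n
(`exists_eventually_card_low_degree`), so at least δ n^{1-cM} of them are isolated in expectation.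
The isolation events are correlated only through the cells joining two vertices. Each vertex has
total intensity at most log n in such cells, so only few pairs are strongly correlated, and the
second moment method applies (`sum_sum_le_of_weakly_correlated`, `measureReal_connected_le`). -/

theorem IsPoissonPointProcess.measure_eq_zero {Ω X : Type*} [MeasurableSpace Ω]
    [MeasurableSpace X] {N : Ω → Measure X} {Λ : Measure X} {P : Measure Ω}
    (h : IsPoissonPointProcess N Λ P) {B : Set X} (hB : MeasurableSet B) (hfin : Λ B ≠ ⊤) :
    P {ω | N ω B = 0} = ENNReal.ofReal (Real.exp (-(Λ B).toReal)) := by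
  have hl := h.hasLaw B hB
  have h1 : P {ω | N ω B = 0} = (P.map (fun ω => N ω B)) {0} := by
    rw [Measure.map_apply_of_aemeasurable hl.aemeasurable (measurableSet_singleton _)]
    rfl
  rw [h1, hl.map_eq, extPoissonLaw, if_neg hfin,
    Measure.map_apply .of_discrete (measurableSet_singleton _)]
  have : (fun k : ℕ => (k : ℝ≥0∞)) ⁻¹' {0} = {0} := by
    ext k; simp
  rw [this, poissonMeasure_singleton]
  simp [ENNReal.coe_toNNReal_eq_toReal]

theorem IsPoissonPointProcess.measurableSet_eq_zero {Ω X : Type*} [MeasurableSpace Ω]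
    [MeasurableSpace X] {N : Ω → Measure X} {Λ : Measure X} {P : Measure Ω}
    (h : IsPoissonPointProcess N Λ P) {B : Set X} (hB : MeasurableSet B) :
    MeasurableSet {ω | N ω B = 0} :=
  ((Measure.measurable_coe hB).comp h.measurable) (measurableSet_singleton 0)

/-! ### The kernel as a measure on the square -/

/-- The measure `W(x,y) dx dy` on the unit square. -/
noncomputable def kernelMass (W : I → I → ℝ≥0) : Measure (I × I) :=
  volume.withDensity fun p => (W p.1 p.2 : ℝ≥0∞)

theorem kernelIntensity_apply (t : ℝ) {W : I → I → ℝ≥0} (hW : Measurable (Function.uncurry W))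
    (B : Set (I × I)) : kernelIntensity t W B = ENNReal.ofReal t * kernelMass W B := by
  have hm : Measurable fun p : I × I => (W p.1 p.2 : ℝ≥0∞) := hW.coe_nnreal_ennreal
  have : kernelIntensity t W = ENNReal.ofReal t • kernelMass W :=
    withDensity_smul _ hm
  rw [this]; rfl

theorem kernelMass_prod {W : I → I → ℝ≥0} (hW : Measurable (Function.uncurry W))
    {A B : Set I} (hA : MeasurableSet A) (hB : MeasurableSet B) :
    kernelMass W (A ×ˢ B) = ∫⁻ x in A, ∫⁻ y in B, (W x y : ℝ≥0∞) := by
  have hm : Measurable fun p : I × I => (W p.1 p.2 : ℝ≥0∞) := hW.coe_nnreal_ennreal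
  rw [kernelMass, withDensity_apply _ (hA.prod hB), Measure.volume_eq_prod,
    ← Measure.prod_restrict, lintegral_prod _ hm.aemeasurable]

theorem kernelMass_prod_univ {W : I → I → ℝ≥0} (hW : Measurable (Function.uncurry W))
    {A : Set I} (hA : MeasurableSet A) :
    kernelMass W (A ×ˢ univ) = ∫⁻ x in A, kernelDegree W x := by
  rw [kernelMass_prod hW hA MeasurableSet.univ]
  simp [kernelDegree]

theorem measurable_kernelDegree {W : I → I → ℝ≥0} (hW : Measurable (Function.uncurry W)) :
    Measurable (kernelDegree W) := by
  have hm : Measurable (Function.uncurry fun x y => (W x y : ℝ≥0∞)) := hW.coe_nnreal_ennreal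
  exact hm.lintegral_prod_right'

theorem kernelMass_preimage_swap {W : I → I → ℝ≥0} (hW_symm : ∀ x y, W x y = W y x)
    {B : Set (I × I)} (hB : MeasurableSet B) :
    kernelMass W (Prod.swap ⁻¹' B) = kernelMass W B := by
  have hs : MeasurePreserving Prod.swap (volume : Measure (I × I)) volume :=
    Measure.measurePreserving_swap
  rw [kernelMass, withDensity_apply _ (measurable_swap hB), withDensity_apply _ hB,
    ← hs.setLIntegral_comp_preimage_emb MeasurableEquiv.prodComm.measurableEmbedding]
  simp only [hW_symm, Prod.fst_swap, Prod.snd_swap, ← preimage_comp, Prod.swap_swap_eq, preimage_id]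

theorem kernelMass_absolutelyContinuous (W : I → I → ℝ≥0) : kernelMass W ≪ volume :=
  withDensity_absolutelyContinuous _ _

/-! ### Vertex regions and crossing regions -/

theorem measurableSet_vertexInterval (n : ℕ) (i : Fin n) :
    MeasurableSet (vertexInterval n i) := by
  unfold vertexInterval
  measurability

/-- The union of the intervals of the vertices in `U`. -/
def vertexRegion (n : ℕ) (U : Finset (Fin n)) : Set I :=
  {x | ∃ i ∈ U, x ∈ vertexInterval n i}

theorem vertexRegion_eq_biUnion (n : ℕ) (U : Finset (Fin n)) :
    vertexRegion n U = ⋃ i ∈ U, vertexInterval n i := by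
  ext x; simp [vertexRegion]

theorem measurableSet_vertexRegion (n : ℕ) (U : Finset (Fin n)) :
    MeasurableSet (vertexRegion n U) := by
  rw [vertexRegion_eq_biUnion]
  exact U.measurableSet_biUnion fun i _ => measurableSet_vertexInterval n i

theorem lt_of_mem_vertexInterval {n : ℕ} {i j : Fin n} {x y : I} (hx : x ∈ vertexInterval n i)
    (hy : y ∈ vertexInterval n j) (hij : i < j) : x < y := by
  have hn : (0 : ℝ) < n := by exact_mod_cast i.pos
  have h1 : (i : ℝ) + 1 ≤ (j : ℝ) := by exact_mod_cast hij
  have h2 : ((i : ℝ) + 1) / n ≤ (j : ℝ) / n := by gcongr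
  exact Subtype.coe_lt_coe.1 (hx.2.trans_lt (h2.trans_lt hy.1))

theorem eq_of_mem_vertexInterval {n : ℕ} {i j : Fin n} {x : I} (hx : x ∈ vertexInterval n i)
    (hy : x ∈ vertexInterval n j) : i = j := by
  rcases lt_trichotomy i j with h | h | h
  · exact absurd (lt_of_mem_vertexInterval hx hy h) (lt_irrefl _)
  · exact h
  · exact absurd (lt_of_mem_vertexInterval hy hx h) (lt_irrefl _)

theorem exists_mem_vertexInterval {n : ℕ} (hn : 0 < n) {x : I} (hx : 0 < x) :
    ∃ i, x ∈ vertexInterval n i := by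
  have hn' : (0 : ℝ) < n := by exact_mod_cast hn
  have hx0 : (0 : ℝ) < x := hx
  have h1 : (x : ℝ) ≤ 1 := x.2.2
  have hpos : 0 < ⌈(x : ℝ) * n⌉₊ := Nat.ceil_pos.2 (by positivity)
  have hle : ⌈(x : ℝ) * n⌉₊ ≤ n := Nat.ceil_le.2 (by nlinarith)
  -- The intervals are open on the left and indexed from 0, hence the ceiling minus one; the point 0
  -- lies in none of them.
  refine ⟨⟨⌈(x : ℝ) * n⌉₊ - 1, by omega⟩, ?_, ?_⟩
  · rw [div_lt_iff₀ hn']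
    exact Nat.lt_ceil.1 (Nat.sub_lt hpos one_pos)
  · rw [le_div_iff₀ hn']
    have := Nat.le_ceil ((x : ℝ) * n)
    simp only [Nat.cast_sub (show 1 ≤ ⌈(x : ℝ) * n⌉₊ from hpos)]
    simpa using this

theorem disjoint_vertexRegion_compl (n : ℕ) (U : Finset (Fin n)) :
    Disjoint (vertexRegion n U) (vertexRegion n Uᶜ) := by
  rw [Set.disjoint_left]
  rintro x ⟨i, hi, hx⟩ ⟨j, hj, hx'⟩
  rw [eq_of_mem_vertexInterval hx hx'] at hi
  exact (Finset.mem_compl.1 hj) hi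

theorem vertexRegion_compl_ae_eq {n : ℕ} (hn : 0 < n) (U : Finset (Fin n)) :
    vertexRegion n Uᶜ =ᵐ[volume] (vertexRegion n U)ᶜ := by
  have h0 : ∀ᵐ x : I, x ≠ 0 := by simp [ae_iff, measure_singleton]
  filter_upwards [h0] with x hx
  have hx' : 0 < x := pos_iff_ne_zero.2 hx
  obtain ⟨i, hi⟩ := exists_mem_vertexInterval hn hx'
  apply propext
  constructor
  · intro h h'
    exact Set.disjoint_left.1 (disjoint_vertexRegion_compl n U) h' h
  · intro h
    by_cases hU : i ∈ U
    · exact absurd ⟨i, hU, hi⟩ h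
    · exact ⟨i, Finset.mem_compl.2 hU, hi⟩

theorem volume_vertexInterval {n : ℕ} (i : Fin n) :
    volume (vertexInterval n i) = ENNReal.ofReal (1 / n) := by
  have hn : (0 : ℝ) < n := by exact_mod_cast i.pos
  have h1 : (i : ℝ) + 1 ≤ n := by exact_mod_cast i.2
  have h : vertexInterval n i = ((↑) : I → ℝ) ⁻¹' (Ioc ((i : ℝ) / n) (((i : ℝ) + 1) / n)) := rfl
  have hsub : Ioc ((i : ℝ) / n) (((i : ℝ) + 1) / n) ⊆ Icc 0 1 := by
    rintro x ⟨hx, hx'⟩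
    exact ⟨le_trans (by positivity) hx.le, hx'.trans ((div_le_one hn).2 h1)⟩
  rw [h, unitInterval.measurePreserving_coe.measure_preimage
    measurableSet_Ioc.nullMeasurableSet, Measure.restrict_apply measurableSet_Ioc,
    inter_eq_left.2 hsub, Real.volume_Ioc]
  congr 1
  field_simp
  ring

theorem lintegral_vertexRegion (n : ℕ) (U : Finset (Fin n)) (f : I → ℝ≥0∞) :
    ∫⁻ x in vertexRegion n U, f x = ∑ i ∈ U, ∫⁻ x in vertexInterval n i, f x := by
  rw [vertexRegion_eq_biUnion, lintegral_biUnion_finset _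
    (fun i _ => measurableSet_vertexInterval n i)]
  intro i _ j _ hij
  exact Set.disjoint_left.2 fun x hx hy => hij (eq_of_mem_vertexInterval hx hy)

theorem volume_vertexRegion (n : ℕ) (U : Finset (Fin n)) :
    volume (vertexRegion n U) = ENNReal.ofReal (U.card / n) := by
  have := lintegral_vertexRegion n U 1
  simp only [Pi.one_apply, lintegral_one, Measure.restrict_apply, MeasurableSet.univ,
    univ_inter, volume_vertexInterval, Finset.sum_const] at this
  rw [this, nsmul_eq_mul, div_eq_mul_one_div (U.card : ℝ), ENNReal.ofReal_mul (by positivity)]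
  simp

/-- The points above the diagonal that give edges between `U` and its complement. -/
def crossingRegion (n : ℕ) (U : Finset (Fin n)) : Set (I × I) :=
  {p | p.1 < p.2} ∩
    (vertexRegion n U ×ˢ vertexRegion n Uᶜ ∪ vertexRegion n Uᶜ ×ˢ vertexRegion n U)

theorem measurableSet_crossingRegion (n : ℕ) (U : Finset (Fin n)) :
    MeasurableSet (crossingRegion n U) :=
  (measurableSet_lt measurable_fst measurable_snd).inter
    (((measurableSet_vertexRegion n U).prod (measurableSet_vertexRegion n Uᶜ)).union
      ((measurableSet_vertexRegion n Uᶜ).prod (measurableSet_vertexRegion n U)))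

/-- Reflection in the diagonal carries the part of A' × A above it onto the part of A × A' below it.
The diagonal itself does not meet A × A', since A and A' are disjoint. -/
theorem kernelMass_crossingRegion {W : I → I → ℝ≥0} (hW_symm : ∀ x y, W x y = W y x)
    (n : ℕ) (U : Finset (Fin n)) :
    kernelMass W (crossingRegion n U) =
      kernelMass W (vertexRegion n U ×ˢ vertexRegion n Uᶜ) := by
  set A := vertexRegion n U
  set A' := vertexRegion n Uᶜ
  have hA : MeasurableSet A := measurableSet_vertexRegion n U
  have hA' : MeasurableSet A' := measurableSet_vertexRegion n Uᶜ
  have hd : Disjoint A A' := disjoint_vertexRegion_compl n U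
  have hlt : MeasurableSet {p : I × I | p.1 < p.2} := measurableSet_lt measurable_fst measurable_snd
  have hgt : MeasurableSet {p : I × I | p.2 < p.1} := measurableSet_lt measurable_snd measurable_fst
  have h1 : crossingRegion n U =
      ({p | p.1 < p.2} ∩ A ×ˢ A') ∪ ({p | p.1 < p.2} ∩ A' ×ˢ A) := by
    rw [← inter_union_distrib_left]; rfl
  have h2 : Prod.swap ⁻¹' ({p : I × I | p.1 < p.2} ∩ A' ×ˢ A) = {p | p.2 < p.1} ∩ A ×ˢ A' := by
    ext p; simp
  have h3 : A ×ˢ A' = ({p | p.1 < p.2} ∩ A ×ˢ A') ∪ ({p | p.2 < p.1} ∩ A ×ˢ A') := by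
    ext p
    constructor
    · intro hp
      rcases lt_trichotomy p.1 p.2 with h | h | h
      · exact Or.inl ⟨h, hp⟩
      · exact absurd (h ▸ hp.2) (Set.disjoint_left.1 hd hp.1)
      · exact Or.inr ⟨h, hp⟩
    · rintro (h | h) <;> exact h.2
  have hm := hlt.inter (hA'.prod hA)
  rw [h1, measure_union _ hm, ← kernelMass_preimage_swap hW_symm hm, h2]
  · conv_rhs => rw [h3]
    rw [measure_union _ (hgt.inter (hA.prod hA'))]
    exact Set.disjoint_left.2 fun p hp hp' => lt_asymm (show p.1 < p.2 from hp.1) hp'.1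
  · exact Set.disjoint_left.2 fun p hp hp' => Set.disjoint_left.1 hd hp.2.1 hp'.2.1

/-! ### Connectedness and crossing regions -/

/-- The set U is what can be reached from a vertex u that fails to reach some v. It may be exchanged
for its complement, which has the same crossing region, so at most half of the vertices are needed.
-/
theorem exists_crossingRegion_eq_zero {n : ℕ} (hn : 0 < n) {m : Measure (I × I)}
    (h : ¬ MultigraphConnected (pointMultigraph n m)) :
    ∃ U : Finset (Fin n), 0 < U.card ∧ 2 * U.card ≤ n ∧ m (crossingRegion n U) = 0 := by
  classical
  suffices ∃ U : Finset (Fin n), U.Nonempty ∧ Uᶜ.Nonempty ∧ m (crossingRegion n U) = 0 by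
    obtain ⟨U, hU, hU', h0⟩ := this
    have hc := U.card_compl_add_card
    rw [Fintype.card_fin] at hc
    by_cases h2 : 2 * U.card ≤ n
    · exact ⟨U, hU.card_pos, h2, h0⟩
    · refine ⟨Uᶜ, hU'.card_pos, by omega, ?_⟩
      rw [← h0, crossingRegion, crossingRegion, compl_compl, union_comm]
  have hne : (pointMultigraph n m).vertexSet.Nonempty := ⟨⟨0, hn⟩, mem_univ _⟩
  simp only [MultigraphConnected, hne, true_and, not_forall] at h
  obtain ⟨u, -, v, -, huv⟩ := h
  set U : Finset (Fin n) :=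
    Finset.univ.filter fun w => Relation.ReflTransGen (pointMultigraph n m).Adj u w with hU
  refine ⟨U, ⟨u, by simp [hU, Relation.ReflTransGen.refl]⟩, ⟨v, by simp [hU, huv]⟩, ?_⟩
  have key : ∀ i j, i ∈ U → j ∉ U → ¬ (pointMultigraph n m).Adj i j := by
    intro i j hi hj hadj
    refine hj ?_
    simp only [hU, Finset.mem_filter, Finset.mem_univ, true_and] at hi ⊢
    exact hi.tail hadj
  have hzero : ∀ i j : Fin n, i ≤ j → ((i ∈ U ∧ j ∉ U) ∨ (i ∉ U ∧ j ∈ U)) →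
      m (vertexInterval n i ×ˢ vertexInterval n j) = 0 := by
    intro i j hij hc
    by_contra hm
    have hlink : (0 : ℝ≥0∞) < m (vertexInterval n i ×ˢ vertexInterval n j) :=
      pos_iff_ne_zero.2 hm
    rcases hc with ⟨hi, hj⟩ | ⟨hi, hj⟩
    -- The label 0 is in use as soon as the cell has positive mass.
    · exact key i j hi hj ⟨(i, j, 0), hij, by simpa using hlink, Or.inl ⟨rfl, rfl⟩⟩
    · exact key j i hj hi ⟨(i, j, 0), hij, by simpa using hlink, Or.inr ⟨rfl, rfl⟩⟩
  have hsub : crossingRegion n U ⊆ ⋃ i : Fin n, ⋃ j : Fin n,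
      ⋃ _ : i ≤ j ∧ ((i ∈ U ∧ j ∉ U) ∨ (i ∉ U ∧ j ∈ U)),
        vertexInterval n i ×ˢ vertexInterval n j := by
    rintro ⟨x, y⟩ ⟨hlt, h⟩
    have aux : ∀ i j, x ∈ vertexInterval n i → y ∈ vertexInterval n j → i ≤ j := by
      intro i j hi hj
      by_contra hij
      exact lt_asymm (lt_of_mem_vertexInterval hj hi (not_le.1 hij)) hlt
    simp only [mem_iUnion]
    rcases h with ⟨⟨i, hi, hx⟩, ⟨j, hj, hy⟩⟩ | ⟨⟨i, hi, hx⟩, ⟨j, hj, hy⟩⟩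
    · exact ⟨i, j, ⟨aux i j hx hy, Or.inl ⟨hi, Finset.mem_compl.1 hj⟩⟩, hx, hy⟩
    · exact ⟨i, j, ⟨aux i j hx hy, Or.inr ⟨Finset.mem_compl.1 hi, hj⟩⟩, hx, hy⟩
  refine measure_mono_null hsub ?_
  simp only [measure_iUnion_null_iff]
  exact fun i j h => hzero i j h.1 h.2

/-- An edge from i to another vertex needs a cell of positive mass. Distinct intervals are ordered,
so that cell lies entirely above the diagonal, inside the crossing region. Only loops can remain at
i. -/
theorem not_multigraphConnected_of_crossingRegion {n : ℕ} (hn : 2 ≤ n) {m : Measure (I × I)}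
    {i : Fin n} (h : m (crossingRegion n {i}) = 0) :
    ¬ MultigraphConnected (pointMultigraph n m) := by
  intro hc
  have hnt : Nontrivial (Fin n) := Fin.nontrivial_iff_two_le.2 hn
  obtain ⟨j, hj⟩ := exists_ne i
  have hreach := hc.2 i (mem_univ _) j (mem_univ _)
  suffices ∀ k, Relation.ReflTransGen (pointMultigraph n m).Adj i k → k = i from
    hj (this j hreach)
  intro k hk
  induction hk with
  | refl => rfl
  | @tail a b _ hab ih =>
    subst ih
    by_contra hb
    obtain ⟨e, hle, hpos, he⟩ := hab
    have hpos' : m (vertexInterval n e.1 ×ˢ vertexInterval n e.2.1) ≠ 0 :=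
      (lt_of_le_of_lt (zero_le) hpos).ne'
    refine hpos' (measure_mono_null ?_ h)
    rintro ⟨x, y⟩ ⟨hx, hy⟩
    rcases he with ⟨h1, h2⟩ | ⟨h1, h2⟩
    · rw [← h1, ← h2] at hle
      simp only [← h1, ← h2] at hx hy
      exact ⟨lt_of_mem_vertexInterval hx hy (lt_of_le_of_ne hle (Ne.symm hb)),
        Or.inl ⟨⟨a, by simp, hx⟩, ⟨b, by simp [hb], hy⟩⟩⟩
    · rw [← h1, ← h2] at hle
      simp only [← h1, ← h2] at hx hy
      exact ⟨lt_of_mem_vertexInterval hx hy (lt_of_le_of_ne hle hb),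
        Or.inr ⟨⟨b, by simp [hb], hx⟩, ⟨a, by simp, hy⟩⟩⟩

/-! ### Weak compactness of sequences of sets -/

/-- Sequential Banach–Alaoglu in L²: the indicators lie in the unit ball, identified with
functionals by Riesz. The bounds on f follow because its integral over any s is a limit of volumes
of s ∩ A m. -/
theorem exists_weak_limit_of_sets (A : ℕ → Set I) (hA : ∀ m, MeasurableSet (A m)) :
    ∃ f : I → ℝ, Measurable f ∧ (∀ᵐ x, 0 ≤ f x ∧ f x ≤ 1) ∧ Integrable f ∧
      ∃ φ : ℕ → ℕ, StrictMono φ ∧ ∀ g : I → ℝ, MemLp g 2 volume →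
        Tendsto (fun m => ∫ x in A (φ m), g x) atTop (𝓝 (∫ x, f x * g x)) := by
  have hfact : Fact ((2 : ℝ≥0∞) ≠ ⊤) := ⟨by simp⟩
  let e : ℕ → Lp ℝ 2 (volume : Measure I) := fun m =>
    indicatorConstLp 2 (hA m) (measure_ne_top _ _) (1 : ℝ)
  have hinner : ∀ m (g : Lp ℝ 2 (volume : Measure I)),
      inner ℝ (e m) g = ∫ x in A m, g x := fun m g =>
    L2.inner_indicatorConstLp_one (hA m) (measure_ne_top _ _) g
  have hnorm : ∀ m, ‖e m‖ ≤ 1 := by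
    intro m
    refine (norm_indicatorConstLp_le).trans ?_
    simp only [norm_one, one_mul]
    exact Real.rpow_le_one measureReal_nonneg measureReal_le_one (by positivity)
  let ψ : ℕ → WeakDual ℝ (Lp ℝ 2 (volume : Measure I)) := fun m =>
    StrongDual.toWeakDual (InnerProductSpace.toDual ℝ _ (e m))
  have hψ : ∀ m, ψ m ∈ WeakDual.toStrongDual ⁻¹'
      Metric.closedBall (0 : StrongDual ℝ (Lp ℝ 2 (volume : Measure I))) 1 := by
    intro m
    simp only [mem_preimage, mem_closedBall_zero_iff]
    exact ((InnerProductSpace.toDual ℝ _).norm_map (e m)).trans_le (hnorm m)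
  obtain ⟨l, -, φ, hφ, hl⟩ := WeakDual.isSeqCompact_closedBall ℝ _ 0 1 hψ
  let F : Lp ℝ 2 (volume : Measure I) :=
    (InnerProductSpace.toDual ℝ _).symm (WeakDual.toStrongDual l)
  have hF : ∀ g : Lp ℝ 2 (volume : Measure I),
      Tendsto (fun m => ∫ x in A (φ m), g x) atTop (𝓝 (inner ℝ F g)) := by
    intro g
    have h1 := (WeakDual.eval_continuous g).continuousAt.tendsto.comp hl
    have h2 : inner ℝ F g = l g := by
      have := InnerProductSpace.toDual_symm_apply (𝕜 := ℝ) (x := g)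
        (y := WeakDual.toStrongDual l)
      exact this
    rw [h2]
    refine h1.congr fun m => ?_
    rw [← hinner]
    rfl
  have hFm : MemLp F 2 volume := Lp.memLp F
  obtain ⟨f, hfm, hfe⟩ : ∃ f : I → ℝ, Measurable f ∧ F =ᵐ[volume] f :=
    hFm.aestronglyMeasurable.aemeasurable
  have hfL2 : MemLp f 2 volume := (memLp_congr_ae hfe).1 hFm
  have hfint : Integrable f := hfL2.integrable (by norm_num)
  have hlim : ∀ g : I → ℝ, MemLp g 2 volume →
      Tendsto (fun m => ∫ x in A (φ m), g x) atTop (𝓝 (∫ x, f x * g x)) := by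
    intro g hg
    have h := hF (hg.toLp g)
    have h1 : inner ℝ F (hg.toLp g) = ∫ x, f x * g x := by
      rw [L2.inner_def]
      refine integral_congr_ae ?_
      filter_upwards [hfe, hg.coeFn_toLp] with x hx hx'
      rw [hx', hx]
      simp [mul_comm]
    rw [h1] at h
    refine h.congr fun m => ?_
    exact integral_congr_ae (ae_restrict_of_ae hg.coeFn_toLp)
  have hset : ∀ s : Set I, MeasurableSet s →
      Tendsto (fun m => volume.real (s ∩ A (φ m))) atTop (𝓝 (∫ x in s, f x)) := by
    intro s hs
    have h := hlim (s.indicator 1) (memLp_indicator_const 2 hs 1 (Or.inr (measure_ne_top _ _)))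
    have h1 : ∫ x, f x * s.indicator 1 x = ∫ x in s, f x := by
      rw [← integral_indicator hs]
      congr 1
      ext x
      by_cases hx : x ∈ s <;> simp [hx]
    rw [h1] at h
    refine h.congr fun m => ?_
    rw [integral_indicator_one hs, measureReal_restrict_apply hs]
  refine ⟨f, hfm, ?_, hfint, φ, hφ, hlim⟩
  have h0 : 0 ≤ᵐ[volume] f := by
    refine ae_nonneg_of_forall_setIntegral_nonneg hfint fun s hs _ => ?_
    exact ge_of_tendsto' (hset s hs) fun m => measureReal_nonneg
  have h1 : f ≤ᵐ[volume] fun _ => (1 : ℝ) := by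
    refine ae_le_of_forall_setIntegral_le hfint (integrable_const _) fun s hs _ => ?_
    rw [setIntegral_const, smul_eq_mul, mul_one]
    exact le_of_tendsto' (hset s hs) fun m => measureReal_mono inter_subset_left
  filter_upwards [h0, h1] with x hx hx'
  exact ⟨hx, hx'⟩

/-! ### Uniform expansion of irreducible kernels -/

theorem KernelIrreducible.volume_eq_zero_or_one {W : I → I → ℝ≥0} (h : KernelIrreducible W)
    {A : Set I} (hA : MeasurableSet A)
    (h0 : ∀ᵐ p : I × I, p.1 ∈ A → p.2 ∉ A → W p.1 p.2 = 0) :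
    volume A = 0 ∨ volume A = 1 := by
  by_contra hc
  push Not at hc
  refine h ⟨A, hA, pos_iff_ne_zero.2 hc.1, lt_of_le_of_ne prob_le_one hc.2, ?_⟩
  rw [← lintegral_indicator (hA.prod hA.compl)]
  refine lintegral_eq_zero_of_ae_eq_zero ?_
  filter_upwards [h0] with p hp
  by_cases hpA : p ∈ A ×ˢ Aᶜ
  · simp [hp hpA.1 hpA.2]
  · simp [indicator_of_notMem hpA]

/-- A fractional cut of mass zero yields a genuine one. Irreducibility applied to {f > 0} forces f >
0 almost everywhere, so W vanishes on I × {f < 1}. Applied to {f ≥ 1}, it leaves f = 1 almost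
everywhere or W = 0 almost everywhere. -/
theorem KernelIrreducible.false_of_weak_cut {W : I → I → ℝ≥0} (hW_irr : KernelIrreducible W)
    {f : I → ℝ} (hf : Measurable f) (hf0 : ¬ f =ᵐ[volume] 0) (hf1 : ¬ f =ᵐ[volume] 1)
    (hf01 : ∀ᵐ x, 0 ≤ f x ∧ f x ≤ 1)
    (h : ∀ᵐ p : I × I, f p.1 * (1 - f p.2) ≠ 0 → W p.1 p.2 = 0) : False := by
  have hfst : ∀ {q : I → Prop}, (∀ᵐ x, q x) → ∀ᵐ p : I × I, q p.1 := fun hq =>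
    Measure.quasiMeasurePreserving_fst.ae hq
  have hA : MeasurableSet {x | 0 < f x} := measurableSet_lt measurable_const hf
  have hB : MeasurableSet {x | 1 ≤ f x} := measurableSet_le measurable_const hf
  have hpos : ∀ᵐ x, 0 < f x := by
    rcases hW_irr.volume_eq_zero_or_one hA (by
      filter_upwards [h, Measure.quasiMeasurePreserving_snd.ae hf01] with p hp hp2 h1 h2
      refine hp (mul_ne_zero (ne_of_gt h1) ?_)
      have : f p.2 = 0 := le_antisymm (not_lt.1 h2) hp2.1
      simp [this]) with h0 | h1
    · refine absurd ?_ hf0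
      have : ∀ᵐ x, ¬ 0 < f x := by simpa [ae_iff] using h0
      filter_upwards [this, hf01] with x hx hx'
      exact le_antisymm (not_lt.1 hx) hx'.1
    · exact (mem_ae_iff_prob_eq_one hA).2 h1
  have h2 : ∀ᵐ p : I × I, f p.2 < 1 → W p.1 p.2 = 0 := by
    filter_upwards [h, hfst hpos] with p hp hp1 hp2
    exact hp (mul_ne_zero hp1.ne' (by linarith))
  rcases hW_irr.volume_eq_zero_or_one hB (by
      filter_upwards [h2] with p hp _ hp2
      exact hp (not_le.1 hp2)) with h0 | h1
  · have hlt : ∀ᵐ x, f x < 1 := by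
      simpa [ae_iff] using h0
    have hW0 : ∀ᵐ p : I × I, W p.1 p.2 = 0 := by
      filter_upwards [h2, Measure.quasiMeasurePreserving_snd.ae hlt] with p hp hp'
      exact hp hp'
    -- The zero kernel is not irreducible: the lower half of the interval is a cut.
    have hv : volume (Iic (⟨1 / 2, by norm_num, by norm_num⟩ : I)) = ENNReal.ofReal (1 / 2) := by
      simp [unitInterval.volume_Iic]
    rcases hW_irr.volume_eq_zero_or_one
        (measurableSet_Iic : MeasurableSet (Iic (⟨1 / 2, by norm_num, by norm_num⟩ : I)))
        (by filter_upwards [hW0] with p hp _ _ using hp) with h | h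
    · rw [hv] at h
      norm_num at h
    · rw [hv] at h
      norm_num at h
  · refine hf1 ?_
    have : ∀ᵐ x, 1 ≤ f x := (mem_ae_iff_prob_eq_one hB).2 h1
    filter_upwards [this, hf01] with x hx hx'
    exact le_antisymm hx'.2 hx

/-- The cut is quadratic in the indicator, so weak convergence alone is not enough. Integration
against w helps: the inner integrals converge for every x and are bounded by 1, hence converge in
L¹, and a strong limit may be paired with a weak one. -/
theorem tendsto_cut_of_weak_limit {w : I → I → ℝ} (hw : Measurable (Function.uncurry w))
    (hw01 : ∀ x y, 0 ≤ w x y ∧ w x y ≤ 1) {A : ℕ → Set I} (hA : ∀ m, MeasurableSet (A m))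
    {f : I → ℝ} (hf : Measurable f) (hf01 : ∀ᵐ x, 0 ≤ f x ∧ f x ≤ 1)
    (hlim : ∀ g : I → ℝ, MemLp g 2 volume →
        Tendsto (fun m => ∫ x in A m, g x) atTop (𝓝 (∫ x, f x * g x))) :
    Tendsto (fun m => ∫ x in A m, ∫ y in (A m)ᶜ, w x y) atTop
      (𝓝 (∫ x, f x * ∫ y, (1 - f y) * w x y)) := by
  have hwx : ∀ x, Measurable (w x) := fun x => hw.of_uncurry_left
  have hwint : ∀ x, Integrable (w x) := fun x =>
    Integrable.of_bound (hwx x).aestronglyMeasurable 1 (Eventually.of_forall fun y => by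
      rw [Real.norm_eq_abs, abs_of_nonneg (hw01 x y).1]; exact (hw01 x y).2)
  have hwL2 : ∀ x, MemLp (w x) 2 volume := fun x =>
    MemLp.of_bound (hwx x).aestronglyMeasurable 1 (Eventually.of_forall fun y => by
      rw [Real.norm_eq_abs, abs_of_nonneg (hw01 x y).1]; exact (hw01 x y).2)
  have hfwint : ∀ x, Integrable (fun y => f y * w x y) := fun x =>
    Integrable.of_bound (hf.mul (hwx x)).aestronglyMeasurable 1 (by
      filter_upwards [hf01] with y hy
      rw [Real.norm_eq_abs, abs_of_nonneg (mul_nonneg hy.1 (hw01 x y).1)]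
      exact mul_le_one₀ hy.2 (hw01 x y).1 (hw01 x y).2)
  set h : I → ℝ := fun x => ∫ y, (1 - f y) * w x y with hh
  set hm : ℕ → I → ℝ := fun m x => ∫ y in (A m)ᶜ, w x y with hhm
  have hh_eq : ∀ x, h x = (∫ y, w x y) - ∫ y, f y * w x y := by
    intro x
    rw [← integral_sub (hwint x) (hfwint x)]
    refine integral_congr_ae (Eventually.of_forall fun y => ?_)
    change (1 - f y) * w x y = w x y - f y * w x y
    ring
  have hm_eq : ∀ m x, hm m x = (∫ y, w x y) - ∫ y in A m, w x y := fun m x =>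
    setIntegral_compl (hA m) (hwint x)
  have hmeas : Measurable h := by
    have : Measurable (Function.uncurry fun x y => (1 - f y) * w x y) :=
      (measurable_const.sub (hf.comp measurable_snd)).mul hw
    exact (this.stronglyMeasurable.integral_prod_right (ν := volume)).measurable
  have hmmeas : ∀ m, Measurable (hm m) := fun m =>
    (hw.stronglyMeasurable.integral_prod_right (ν := volume.restrict (A m)ᶜ)).measurable
  have hpt : ∀ x, Tendsto (fun m => hm m x) atTop (𝓝 (h x)) := by
    intro x
    simp only [hm_eq, hh_eq]
    exact (hlim (w x) (hwL2 x)).const_sub _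
  have hmbound : ∀ m x, ‖hm m x‖ ≤ 1 := by
    intro m x
    have h0 : 0 ≤ hm m x := integral_nonneg fun y => (hw01 x y).1
    rw [Real.norm_eq_abs, abs_of_nonneg h0]
    calc hm m x ≤ ∫ y, w x y := setIntegral_le_integral (hwint x)
          (Eventually.of_forall fun y => (hw01 x y).1)
      _ ≤ ∫ _ : I, (1 : ℝ) := integral_mono (hwint x) (integrable_const _) fun y => (hw01 x y).2
      _ = 1 := by simp
  have hbound : ∀ x, ‖h x‖ ≤ 1 := fun x =>
    le_of_tendsto' (hpt x).norm fun m => hmbound m x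
  have hint : Integrable h := Integrable.of_bound hmeas.aestronglyMeasurable 1
    (Eventually.of_forall hbound)
  have hmint : ∀ m, Integrable (hm m) := fun m =>
    Integrable.of_bound (hmmeas m).aestronglyMeasurable 1 (Eventually.of_forall (hmbound m))
  have hL1 : Tendsto (fun m => ∫ x, ‖hm m x - h x‖) atTop (𝓝 0) := by
    have := tendsto_integral_of_dominated_convergence (μ := (volume : Measure I))
      (F := fun m x => ‖hm m x - h x‖) (f := fun _ => (0 : ℝ)) (fun _ => (2 : ℝ))
      (fun m => ((hmmeas m).sub hmeas).norm.aestronglyMeasurable) (integrable_const _)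
      (fun m => Eventually.of_forall fun x => by
        rw [norm_norm]
        linarith [norm_sub_le (hm m x) (h x), hmbound m x, hbound x])
      (Eventually.of_forall fun x => by
        simpa using ((hpt x).sub_const (h x)).norm)
    simpa using this
  have hdiff : Tendsto (fun m => ∫ x in A m, (hm m x - h x)) atTop (𝓝 0) := by
    refine squeeze_zero_norm (fun m => ?_) hL1
    refine (norm_integral_le_integral_norm _).trans ?_
    exact setIntegral_le_integral ((hmint m).sub hint).norm
      (Eventually.of_forall fun x => norm_nonneg _)
  have hmain := hlim h (MemLp.of_bound hmeas.aestronglyMeasurable 1 (Eventually.of_forall hbound))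
  have := hmain.add hdiff
  rw [add_zero] at this
  refine this.congr fun m => ?_
  refine (integral_add (f := h) (g := fun x => hm m x - h x) hint.integrableOn
    ((hmint m).sub hint).integrableOn).symm.trans ?_
  refine integral_congr_ae (Eventually.of_forall fun x => ?_)
  exact add_sub_cancel (h x) (hm m x)

/-- Otherwise sets A m with cut mass tending to 0 have a weak limit f with f(x)(1 - f(y))W(x,y) = 0
almost everywhere. The volume bounds pass to the integral of f, so f is neither 0 nor 1 almost
everywhere, contradicting irreducibility. -/
theorem exists_kernelMass_compl_ge {W : I → I → ℝ≥0} (hW : Measurable (Function.uncurry W))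
    (hW_irr : KernelIrreducible W) {δ : ℝ} (hδ : 0 < δ) :
    ∃ κ : ℝ, 0 < κ ∧ ∀ A : Set I, MeasurableSet A → δ ≤ volume.real A → volume.real A ≤ 1 / 2 →
      ENNReal.ofReal κ ≤ kernelMass W (A ×ˢ Aᶜ) := by
  by_contra hcon
  push Not at hcon
  have hseq : ∀ m : ℕ, ∃ A : Set I, MeasurableSet A ∧ δ ≤ volume.real A ∧
      volume.real A ≤ 1 / 2 ∧ kernelMass W (A ×ˢ Aᶜ) < ENNReal.ofReal (1 / ((m : ℝ) + 1)) := by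
    intro m
    obtain ⟨A, h1, h2, h3, h4⟩ := hcon (1 / ((m : ℝ) + 1)) (by positivity)
    exact ⟨A, h1, h2, h3, h4⟩
  choose A hA hAδ hA2 hAW using hseq
  obtain ⟨f, hf, hf01, hfint, φ, hφ, hlim⟩ := exists_weak_limit_of_sets A hA
  -- The truncation is bounded, so no integrability of W is needed, and it has the same zeros as W.
  let w : I → I → ℝ := fun x y => min (W x y : ℝ) 1
  have hw : Measurable (Function.uncurry w) := by
    have : Measurable fun p : I × I => (W p.1 p.2 : ℝ) := hW.coe_nnreal_real
    exact this.min measurable_const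
  have hw01 : ∀ x y, 0 ≤ w x y ∧ w x y ≤ 1 := fun x y =>
    ⟨le_min (W x y).2 zero_le_one, min_le_right _ _⟩
  have htend := tendsto_cut_of_weak_limit hw hw01 (fun m => hA (φ m)) hf hf01 hlim
  have hzero : Tendsto (fun m => ∫ x in A (φ m), ∫ y in (A (φ m))ᶜ, w x y) atTop (𝓝 0) := by
    refine squeeze_zero (fun m => integral_nonneg fun x => integral_nonneg fun y => (hw01 x y).1)
      (fun m => ?_) (tendsto_one_div_add_atTop_nhds_zero_nat.comp hφ.tendsto_atTop)
    have hs : Integrable (Function.uncurry w)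
        ((volume.restrict (A (φ m))).prod (volume.restrict (A (φ m))ᶜ)) :=
      Integrable.of_bound hw.aestronglyMeasurable 1 (Eventually.of_forall fun p => by
        exact (abs_of_nonneg (hw01 p.1 p.2).1).trans_le (hw01 p.1 p.2).2)
    have h1 : ENNReal.ofReal (∫ x in A (φ m), ∫ y in (A (φ m))ᶜ, w x y) ≤
        ENNReal.ofReal (1 / ((φ m : ℝ) + 1)) := by
      rw [integral_integral hs]
      refine (ofReal_integral_eq_lintegral_ofReal hs
        (Eventually.of_forall fun p => (hw01 p.1 p.2).1)).trans_le ?_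
      refine le_trans ?_ (hAW (φ m)).le
      rw [kernelMass, withDensity_apply _ ((hA _).prod (hA _).compl), Measure.volume_eq_prod,
        ← Measure.prod_restrict]
      refine lintegral_mono fun p => ?_
      rw [← ENNReal.ofReal_coe_nnreal]
      exact ENNReal.ofReal_le_ofReal (min_le_left _ _)
    exact (ENNReal.ofReal_le_ofReal_iff Nat.one_div_pos_of_nat.le).1 h1
  have heq := tendsto_nhds_unique htend hzero
  have hcut : ∀ᵐ p : I × I, f p.1 * (1 - f p.2) * w p.1 p.2 = 0 := by
    have hnn : ∀ᵐ p : I × I, 0 ≤ f p.1 * (1 - f p.2) * w p.1 p.2 ∧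
        f p.1 * (1 - f p.2) * w p.1 p.2 ≤ 1 := by
      filter_upwards [Measure.quasiMeasurePreserving_fst.ae hf01,
        Measure.quasiMeasurePreserving_snd.ae hf01] with p h1 h2
      have h3 := hw01 p.1 p.2
      have h4 : 0 ≤ f p.1 * (1 - f p.2) := mul_nonneg h1.1 (by linarith)
      have h5 : f p.1 * (1 - f p.2) ≤ 1 := mul_le_one₀ h1.2 (by linarith) (by linarith)
      exact ⟨mul_nonneg h4 h3.1, mul_le_one₀ h5 h3.1 h3.2⟩
    have hmeas : Measurable fun p : I × I => f p.1 * (1 - f p.2) * w p.1 p.2 :=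
      ((hf.comp measurable_fst).mul (measurable_const.sub (hf.comp measurable_snd))).mul hw
    have hint : Integrable fun p : I × I => f p.1 * (1 - f p.2) * w p.1 p.2 :=
      Integrable.of_bound hmeas.aestronglyMeasurable 1 (by
        filter_upwards [hnn] with p hp
        rw [Real.norm_eq_abs, abs_of_nonneg hp.1]
        exact hp.2)
    have h0 : ∫ p : I × I, f p.1 * (1 - f p.2) * w p.1 p.2 = 0 := by
      rw [Measure.volume_eq_prod, integral_prod _ hint, ← heq]
      congr 1; ext x
      rw [← integral_const_mul]
      congr 1; ext y; ring
    exact (integral_eq_zero_iff_of_nonneg_ae (hnn.mono fun p hp => hp.1) hint).1 h0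
  have hvol : Tendsto (fun m => volume.real (A (φ m))) atTop (𝓝 (∫ x, f x)) := by
    have := hlim (fun _ => 1) (memLp_const 1)
    simpa using this
  refine hW_irr.false_of_weak_cut hf (fun h0 => ?_) (fun h1 => ?_) hf01 ?_
  · rw [integral_congr_ae h0] at hvol
    have := ge_of_tendsto' hvol fun m => hAδ (φ m)
    simp at this
    linarith
  · rw [integral_congr_ae h1] at hvol
    have := le_of_tendsto' hvol fun m => hA2 (φ m)
    simp at this
    norm_num at this
  · filter_upwards [hcut] with p hp hne
    have h1 : w p.1 p.2 = 0 := (mul_eq_zero.1 hp).resolve_left hne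
    rcases min_choice (W p.1 p.2 : ℝ) 1 with h2 | h2
    · exact_mod_cast h2.symm.trans h1
    · exact absurd (h2.symm.trans h1) one_ne_zero

/-! ### Small sets -/

/-- The mass of A × Aᶜ is that of A × I, at least ν₀|A|, less that of A × A. Hölder bounds the
latter by ‖W‖_q |A|^{2 - 2/q}, where q > 2 is what makes the exponent exceed 1. -/
theorem exists_kernelMass_compl_ge_of_small {W : I → I → ℝ≥0}
    (hW : Measurable (Function.uncurry W)) {q : ℝ≥0∞} (hq : 2 < q)
    (hWq : MemLp (fun p : I × I => (W p.1 p.2 : ℝ)) q volume) {c : ℝ≥0}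
    (hc : 1 < (c : ℝ≥0∞) * kernelMinDegree W) :
    ∃ δ : ℝ, 0 < δ ∧ ∃ ε : ℝ, 0 < ε ∧ ∀ A : Set I, MeasurableSet A → volume.real A ≤ δ →
      (1 + ε) * volume.real A ≤ c * (kernelMass W).real (A ×ˢ Aᶜ) := by
  have hW1 : MemLp (fun p : I × I => (W p.1 p.2 : ℝ)) 1 volume :=
    hWq.mono_exponent (by
      refine le_trans ?_ hq.le
      norm_num)
  have henorm : ∀ p : I × I, ‖(W p.1 p.2 : ℝ)‖ₑ = (W p.1 p.2 : ℝ≥0∞) := fun p => by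
    simp
  have hmass : ∀ B : Set (I × I), MeasurableSet B →
      kernelMass W B = eLpNorm (fun p : I × I => (W p.1 p.2 : ℝ)) 1 (volume.restrict B) := by
    intro B hB
    rw [kernelMass, withDensity_apply _ hB, eLpNorm_one_eq_lintegral_enorm]
    simp only [henorm]
  have hfin : IsFiniteMeasure (kernelMass W) := by
    refine ⟨?_⟩
    rw [hmass _ MeasurableSet.univ, Measure.restrict_univ]
    exact hW1.2
  set ν := (kernelMinDegree W).toReal with hν
  have hdeg : ∀ A : Set I, MeasurableSet A →
      kernelMinDegree W * volume A ≤ kernelMass W (A ×ˢ univ) := by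
    intro A hA
    rw [kernelMass_prod_univ hW hA, ← setLIntegral_const]
    refine lintegral_mono_ae (ae_restrict_of_ae ?_)
    exact ae_essInf_le
  have hνfin : kernelMinDegree W ≠ ⊤ := by
    intro h
    have := hdeg univ MeasurableSet.univ
    rw [h] at this
    simp only [measure_univ, mul_one, top_le_iff] at this
    exact measure_ne_top _ _ this
  have hcν : 1 < c * ν := by
    have : (1 : ℝ≥0∞).toReal < ((c : ℝ≥0∞) * kernelMinDegree W).toReal :=
      ENNReal.toReal_strict_mono (ENNReal.mul_ne_top ENNReal.coe_ne_top hνfin) hc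
    simpa [ENNReal.toReal_mul] using this
  set C := (eLpNorm (fun p : I × I => (W p.1 p.2 : ℝ)) q volume).toReal with hC
  -- For q = ⊤ the conventions `toReal ⊤ = 0` and `1 / 0 = 0` give s = 1, the right Hölder exponent.
  set s : ℝ := 1 - 1 / q.toReal with hs
  have hs2 : 0 < 2 * s - 1 := by
    rcases eq_or_ne q ⊤ with rfl | hqt
    · simp [hs]
    · have h2 : (2 : ℝ) < q.toReal := by
        simpa using (ENNReal.toReal_lt_toReal (by simp) hqt).2 hq
      have : 1 / q.toReal < 1 / 2 := one_div_lt_one_div_of_lt (by norm_num) h2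
      rw [hs]; linarith
  have hholder : ∀ A : Set I, MeasurableSet A →
      (kernelMass W).real (A ×ˢ A) ≤ C * (volume.real A * volume.real A ^ (2 * s - 1)) := by
    intro A hA
    have h1 : kernelMass W (A ×ˢ A) ≤
        eLpNorm (fun p : I × I => (W p.1 p.2 : ℝ)) q volume * (volume A * volume A) ^ s := by
      rw [hmass _ (hA.prod hA)]
      refine (eLpNorm_le_eLpNorm_mul_rpow_measure_univ (p := 1) (q := q)
        (le_trans (by norm_num) hq.le) hWq.1.restrict).trans ?_
      gcongr
      · exact Measure.restrict_le_self
      · rw [Measure.restrict_apply MeasurableSet.univ, univ_inter, Measure.volume_eq_prod,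
          Measure.prod_prod, hs]
        simp
    have h2 := ENNReal.toReal_mono (ENNReal.mul_ne_top hWq.2.ne
      (ENNReal.rpow_ne_top_of_nonneg (by linarith)
        (ENNReal.mul_ne_top (measure_ne_top _ _) (measure_ne_top _ _)))) h1
    rw [ENNReal.toReal_mul, ← ENNReal.toReal_rpow, ENNReal.toReal_mul] at h2
    refine h2.trans (le_of_eq ?_)
    change C * (volume.real A * volume.real A) ^ s = _
    rcases eq_or_lt_of_le (measureReal_nonneg (μ := volume) (s := A)) with h0 | h0
    · rw [← h0, zero_mul, zero_mul, Real.zero_rpow (by linarith)]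
    · congr 1
      rw [Real.mul_rpow h0.le h0.le, ← Real.rpow_add h0, Real.rpow_sub_one h0.ne',
        mul_div_cancel₀ _ h0.ne']
      congr 1; ring
  have hlim : Tendsto (fun a : ℝ => c * (ν - C * a ^ (2 * s - 1))) (𝓝 0) (𝓝 (c * ν)) := by
    have h1 : ContinuousAt (fun a : ℝ => c * (ν - C * a ^ (2 * s - 1))) 0 :=
      continuousAt_const.mul (continuousAt_const.sub (continuousAt_const.mul
        (Real.continuousAt_rpow_const 0 (2 * s - 1) (Or.inr hs2.le))))
    have h2 := h1.tendsto
    simpa [Real.zero_rpow hs2.ne'] using h2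
  -- The midpoint of 1 and cν is 1 + ε for ε = (cν - 1)/2.
  have hev := hlim.eventually (lt_mem_nhds (show (1 + c * ν) / 2 < c * ν by linarith))
  obtain ⟨r, hr, hball⟩ := Metric.eventually_nhds_iff.1 hev
  refine ⟨r / 2, by linarith, (c * ν - 1) / 2, by linarith, fun A hA hAr => ?_⟩
  have ha0 : 0 ≤ volume.real A := measureReal_nonneg
  have h1 := @hball (volume.real A) (by
    rw [Real.dist_eq, sub_zero, abs_of_nonneg ha0]; linarith)
  have h2 : ν * volume.real A ≤ (kernelMass W).real (A ×ˢ univ) := by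
    have := ENNReal.toReal_mono (measure_ne_top _ _) (hdeg A hA)
    rwa [ENNReal.toReal_mul] at this
  have h3 : (kernelMass W).real (A ×ˢ univ) =
      (kernelMass W).real (A ×ˢ A) + (kernelMass W).real (A ×ˢ Aᶜ) := by
    rw [← measureReal_union _ (hA.prod hA.compl), ← prod_union, union_compl_self]
    exact Set.disjoint_left.2 fun p hp hp' => hp'.2 hp.2
  have h4 := hholder A hA
  have h5 : (ν - C * volume.real A ^ (2 * s - 1)) * volume.real A ≤
      (kernelMass W).real (A ×ˢ Aᶜ) := by nlinarith
  calc (1 + (c * ν - 1) / 2) * volume.real A = (1 + c * ν) / 2 * volume.real A := by ring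
    _ ≤ c * (ν - C * volume.real A ^ (2 * s - 1)) * volume.real A := by gcongr
    _ = c * ((ν - C * volume.real A ^ (2 * s - 1)) * volume.real A) := by ring
    _ ≤ _ := by gcongr

/-! ### Connectedness above the threshold -/

theorem measureReal_vertexRegion (n : ℕ) (U : Finset (Fin n)) :
    volume.real (vertexRegion n U) = U.card / n := by
  rw [measureReal_def, volume_vertexRegion, ENNReal.toReal_ofReal (by positivity)]

theorem kernelMass_crossingRegion_eq_compl {W : I → I → ℝ≥0} (hW_symm : ∀ x y, W x y = W y x)
    {n : ℕ} (hn : 0 < n) (U : Finset (Fin n)) :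
    kernelMass W (crossingRegion n U) =
      kernelMass W (vertexRegion n U ×ˢ (vertexRegion n U)ᶜ) := by
  rw [kernelMass_crossingRegion hW_symm]
  refine measure_congr ((kernelMass_absolutelyContinuous W).ae_le ?_)
  exact Measure.set_prod_ae_eq EventuallyEq.rfl (vertexRegion_compl_ae_eq hn U)

theorem isFiniteMeasure_kernelMass {W : I → I → ℝ≥0} {q : ℝ≥0∞} (hq : 1 ≤ q)
    (hWq : MemLp (fun p : I × I => (W p.1 p.2 : ℝ)) q volume) :
    IsFiniteMeasure (kernelMass W) := by
  refine isFiniteMeasure_withDensity ?_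
  have h := (hWq.mono_exponent hq).2
  rw [eLpNorm_one_eq_lintegral_enorm] at h
  simpa using h.ne

/-- The binomial theorem over all subsets; leaving out the empty set produces the -1 that lets the
union bound tend to 0. -/
theorem sum_nonempty_pow_card_add {n : ℕ} (r b : ℝ) :
    ∑ U ∈ (Finset.univ : Finset (Finset (Fin n))).filter Finset.Nonempty, (r ^ U.card + b) ≤
      (1 + r) ^ n - 1 + ∑ _U ∈ (Finset.univ : Finset (Finset (Fin n))).filter Finset.Nonempty,
        b := by
  have h1 : ∑ U : Finset (Fin n), r ^ U.card = (1 + r) ^ n := by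
    have := Fintype.sum_pow_mul_eq_add_pow (Fin n) r 1
    simp only [one_pow, mul_one, Fintype.card_fin] at this
    rw [this, add_comm]
  have h2 := Finset.sum_filter_add_sum_filter_not (Finset.univ : Finset (Finset (Fin n)))
    Finset.Nonempty (fun U => r ^ U.card)
  have h3 : (Finset.univ : Finset (Finset (Fin n))).filter (fun U => ¬ U.Nonempty) = {∅} := by
    ext U; simp [Finset.not_nonempty_iff_eq_empty]
  rw [h3, Finset.sum_singleton, Finset.card_empty, pow_zero, h1] at h2
  rw [Finset.sum_add_distrib]
  linarith

theorem measure_not_connected_le {W : I → I → ℝ≥0} (hW : Measurable (Function.uncurry W))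
    (hW_symm : ∀ x y, W x y = W y x) [IsFiniteMeasure (kernelMass W)] {c δ ε κ : ℝ} (hc : 0 ≤ c)
    (hsmall : ∀ A : Set I, MeasurableSet A → volume.real A ≤ δ →
      (1 + ε) * volume.real A ≤ c * (kernelMass W).real (A ×ˢ Aᶜ))
    (hlarge : ∀ A : Set I, MeasurableSet A → δ ≤ volume.real A → volume.real A ≤ 1 / 2 →
      ENNReal.ofReal κ ≤ kernelMass W (A ×ˢ Aᶜ))
    {n : ℕ} (hn : 2 ≤ n) {Ω : Type*} [MeasurableSpace Ω] {P : Measure Ω} [IsProbabilityMeasure P]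
    {N : Ω → Measure (I × I)}
    (hN : IsPoissonPointProcess N (kernelIntensity (c * n * Real.log n) W) P) :
    P {ω | ¬ MultigraphConnected (pointMultigraph n (N ω))} ≤
      ENNReal.ofReal ((1 + Real.exp (-((1 + ε) * Real.log n))) ^ n - 1 +
        2 ^ n * Real.exp (-(c * n * Real.log n * κ))) := by
  have hn0 : (0 : ℝ) < n := by positivity
  have hlog : 0 ≤ Real.log n := Real.log_natCast_nonneg n
  set t := c * n * Real.log n with ht
  have ht0 : 0 ≤ t := by positivity
  set r := Real.exp (-((1 + ε) * Real.log n)) with hr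
  set b := Real.exp (-(t * κ)) with hb
  have hr0 : 0 < r := Real.exp_pos _
  have hb0 : 0 < b := Real.exp_pos _
  set T := ((Finset.univ : Finset (Finset (Fin n))).filter Finset.Nonempty).filter
    (fun U => 2 * U.card ≤ n) with hT
  have hsub : {ω | ¬ MultigraphConnected (pointMultigraph n (N ω))} ⊆
      ⋃ U ∈ T, {ω | N ω (crossingRegion n U) = 0} := by
    intro ω hω
    obtain ⟨U, h1, h2, h3⟩ := exists_crossingRegion_eq_zero (by omega) hω
    simp only [mem_iUnion]
    exact ⟨U, by simp [hT, h2, Finset.card_pos.1 h1], h3⟩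
  -- Small sets are bounded by the first term and large ones by the second. Adding both avoids
  -- splitting the sum over U.
  have hprob : ∀ U ∈ T, P {ω | N ω (crossingRegion n U) = 0} ≤ ENNReal.ofReal (r ^ U.card + b) := by
    intro U hU
    have hU2 : 2 * U.card ≤ n := (Finset.mem_filter.1 hU).2
    have hΛ : kernelIntensity t W (crossingRegion n U) =
        ENNReal.ofReal t * kernelMass W (vertexRegion n U ×ˢ (vertexRegion n U)ᶜ) := by
      rw [kernelIntensity_apply _ hW, kernelMass_crossingRegion_eq_compl hW_symm (by omega)]
    rw [hN.measure_eq_zero (measurableSet_crossingRegion n U)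
      (by rw [hΛ]; exact ENNReal.mul_ne_top ENNReal.ofReal_ne_top (measure_ne_top _ _)), hΛ,
      ENNReal.toReal_mul, ENNReal.toReal_ofReal ht0, ← measureReal_def]
    refine ENNReal.ofReal_le_ofReal ?_
    have hA := measurableSet_vertexRegion n U
    have hv := measureReal_vertexRegion n U
    set A := vertexRegion n U
    rcases le_total (volume.real A) δ with h | h
    · have h1 := hsmall A hA h
      have h2 : Real.exp (-(t * (kernelMass W).real (A ×ˢ Aᶜ))) ≤ r ^ U.card := by
        rw [hr, ← Real.exp_nat_mul, Real.exp_le_exp]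
        have h3 : (n * Real.log n) * ((1 + ε) * volume.real A) ≤
            (n * Real.log n) * (c * (kernelMass W).real (A ×ˢ Aᶜ)) := by gcongr
        have h4 : (n * Real.log n) * ((1 + ε) * volume.real A) =
            U.card * ((1 + ε) * Real.log n) := by
          rw [hv]; field_simp
        rw [h4] at h3
        rw [ht]
        linarith
      linarith
    · have h1 := hlarge A hA h (by
        rw [hv, div_le_div_iff₀ hn0 two_pos]
        have : (2 : ℝ) * U.card ≤ n := by exact_mod_cast hU2
        linarith)
      have h2 : κ ≤ (kernelMass W).real (A ×ˢ Aᶜ) :=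
        (ENNReal.ofReal_le_iff_le_toReal (measure_ne_top _ _)).1 h1
      have h3 : Real.exp (-(t * (kernelMass W).real (A ×ˢ Aᶜ))) ≤ b := by
        rw [hb, Real.exp_le_exp]
        gcongr
      have : 0 < r ^ U.card := by positivity
      linarith
  have hnn : ∀ U : Finset (Fin n), 0 ≤ r ^ U.card + b := fun U => by positivity
  calc P {ω | ¬ MultigraphConnected (pointMultigraph n (N ω))}
      ≤ ∑ U ∈ T, P {ω | N ω (crossingRegion n U) = 0} :=
        (measure_mono hsub).trans (measure_biUnion_finset_le _ _)
    _ ≤ ∑ U ∈ T, ENNReal.ofReal (r ^ U.card + b) := Finset.sum_le_sum hprob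
    _ = ENNReal.ofReal (∑ U ∈ T, (r ^ U.card + b)) :=
        (ENNReal.ofReal_sum_of_nonneg fun U _ => hnn U).symm
    _ ≤ _ := by
      refine ENNReal.ofReal_le_ofReal ?_
      -- The restriction to at most half of the vertices has served its purpose; dropping it makes
      -- the binomial sum complete.
      refine (Finset.sum_le_sum_of_subset_of_nonneg (Finset.filter_subset _ _)
        fun U _ _ => hnn U).trans ?_
      refine (sum_nonempty_pow_card_add r b).trans ?_
      rw [Finset.sum_const, nsmul_eq_mul]
      have h1 : (((Finset.univ : Finset (Finset (Fin n))).filter Finset.Nonempty).card : ℝ) ≤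
          2 ^ n := by
        have := Finset.card_filter_le (Finset.univ : Finset (Finset (Fin n))) Finset.Nonempty
        rw [Finset.card_univ, Fintype.card_finset, Fintype.card_fin] at this
        exact_mod_cast this
      gcongr

/-- The power is at most exp(n^{-ε}), because 1 + x ≤ e^x, and the second term equals exp(-n(cκ log
n - log 2)). -/
theorem tendsto_cut_union_bound {ε κ c : ℝ} (hε : 0 < ε) (hκ : 0 < κ) (hc : 0 < c) :
    Tendsto (fun n : ℕ => (1 + Real.exp (-((1 + ε) * Real.log n))) ^ n - 1 +
        2 ^ n * Real.exp (-(c * n * Real.log n * κ))) atTop (𝓝 0) := by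
  have hlog : Tendsto (fun n : ℕ => Real.log n) atTop atTop :=
    Real.tendsto_log_atTop.comp tendsto_natCast_atTop_atTop
  have h1 : Tendsto (fun n : ℕ => Real.exp (Real.exp (-(ε * Real.log n))) - 1) atTop (𝓝 0) := by
    have h2 : Tendsto (fun n : ℕ => Real.exp (-(ε * Real.log n))) atTop (𝓝 0) :=
      Real.tendsto_exp_neg_atTop_nhds_zero.comp (hlog.const_mul_atTop hε)
    have h3 := ((Real.continuous_exp.tendsto 0).comp h2).sub_const 1
    simpa using h3
  have h2 : Tendsto (fun n : ℕ => Real.exp (-((n : ℝ) * (c * κ * Real.log n - Real.log 2))))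
      atTop (𝓝 0) :=
    Real.tendsto_exp_neg_atTop_nhds_zero.comp (tendsto_natCast_atTop_atTop.atTop_mul_atTop₀
      (tendsto_atTop_add_const_right _ _ (hlog.const_mul_atTop (mul_pos hc hκ))))
  have h3 := h1.add h2
  rw [add_zero] at h3
  refine squeeze_zero' ?_ ?_ h3
  · refine Eventually.of_forall fun n => ?_
    have : 1 ≤ (1 + Real.exp (-((1 + ε) * Real.log n))) ^ n :=
      one_le_pow₀ (by linarith [Real.exp_pos (-((1 + ε) * Real.log n))])
    have h4 : 0 < 2 ^ n * Real.exp (-(c * n * Real.log n * κ)) := by positivity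
    linarith
  · filter_upwards [eventually_gt_atTop 0] with n hn
    have hn0 : (0 : ℝ) < n := by exact_mod_cast hn
    refine add_le_add (sub_le_sub_right ?_ 1) (le_of_eq ?_)
    · have h4 : (n : ℝ) * Real.exp (-((1 + ε) * Real.log n)) = Real.exp (-(ε * Real.log n)) := by
        conv_lhs => rw [← Real.exp_log hn0, Real.log_exp]
        rw [← Real.exp_add]
        congr 1; ring
      rw [← h4, Real.exp_nat_mul]
      gcongr
      linarith [Real.add_one_le_exp (Real.exp (-((1 + ε) * Real.log n)))]
    · have h5 : (2 : ℝ) ^ n = Real.exp (n * Real.log 2) := by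
        rw [Real.exp_nat_mul, Real.exp_log two_pos]
      rw [h5, ← Real.exp_add]
      congr 1; ring

theorem tendsto_measure_connected_one {W : I → I → ℝ≥0}
    (hW : Measurable (Function.uncurry W)) (hW_symm : ∀ x y, W x y = W y x)
    (hW_irr : KernelIrreducible W) {c : ℝ≥0} {Ω : ℕ → Type*} [∀ n, MeasurableSpace (Ω n)]
    {P : ∀ n, Measure (Ω n)} [∀ n, IsProbabilityMeasure (P n)] {N : ∀ n, Ω n → Measure (I × I)}
    (hN : ∀ n, 2 ≤ n →
      IsPoissonPointProcess (N n) (kernelIntensity ((c : ℝ) * n * Real.log n) W) (P n))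
    (hc : 1 / kernelMinDegree W < (c : ℝ≥0∞)) {q : ℝ≥0∞} (hq : 2 < q)
    (hWq : MemLp (fun p : I × I => (W p.1 p.2 : ℝ)) q volume) :
    Tendsto (fun n => P n {ω | MultigraphConnected (pointMultigraph n (N n ω))})
      atTop (𝓝 1) := by
  have hc1 : 1 < (c : ℝ≥0∞) * kernelMinDegree W :=
    (ENNReal.div_lt_iff (Or.inr one_ne_zero) (Or.inr ENNReal.one_ne_top)).1 hc
  have hc0 : 0 < (c : ℝ) := by
    rw [NNReal.coe_pos, pos_iff_ne_zero]
    rintro rfl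
    simp at hc1
  have hfin : IsFiniteMeasure (kernelMass W) :=
    isFiniteMeasure_kernelMass (le_trans (by norm_num) hq.le) hWq
  obtain ⟨δ, hδ, ε, hε, hsmall⟩ := exists_kernelMass_compl_ge_of_small hW hq hWq hc1
  obtain ⟨κ, hκ, hlarge⟩ := exists_kernelMass_compl_ge hW hW_irr hδ
  have hlim := ENNReal.tendsto_ofReal (tendsto_cut_union_bound hε hκ hc0)
  rw [ENNReal.ofReal_zero] at hlim
  have hlow := ENNReal.Tendsto.sub (tendsto_const_nhds (x := (1 : ℝ≥0∞))) hlim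
    (Or.inl ENNReal.one_ne_top)
  rw [tsub_zero] at hlow
  refine tendsto_of_tendsto_of_tendsto_of_le_of_le' hlow tendsto_const_nhds ?_
    (Eventually.of_forall fun n => prob_le_one)
  filter_upwards [eventually_ge_atTop 2] with n hn
  have hbound := measure_not_connected_le hW hW_symm c.2 hsmall hlarge hn (hN n hn)
  rw [tsub_le_iff_right]
  -- Subadditivity suffices here, so measurability of the connectedness event is not needed.
  calc (1 : ℝ≥0∞) = P n univ := measure_univ.symm
    _ ≤ P n ({ω | MultigraphConnected (pointMultigraph n (N n ω))} ∪
          {ω | ¬ MultigraphConnected (pointMultigraph n (N n ω))}) :=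
        measure_mono fun ω _ => em _
    _ ≤ _ := (measure_union_le _ _).trans (add_le_add le_rfl hbound)

/-! ### Vertices of small degree -/

/-- Lebesgue differentiation along the intervals containing x. They are not centred at x, so the
Vitali family of a doubling measure is used, which admits balls that merely contain x. -/
theorem ae_eventually_lintegral_vertexInterval_le {H : I → ℝ≥0∞} (hH : Measurable H) {U : Set I}
    (hU : IsOpen U) (hUfin : ∫⁻ x in U, H x ≠ ⊤) (M : ℝ≥0∞) :
    ∀ᵐ x, x ∈ U → H x < M → ∀ᶠ n : ℕ in atTop, ∃ i : Fin n, x ∈ vertexInterval n i ∧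
      ∫⁻ y in vertexInterval n i, H y ≤ M * ENNReal.ofReal (1 / n) := by
  -- The differentiation theorem is applied on ℝ, to an extension of H cut off outside U so that its
  -- integral over [0,1] is finite.
  let f : ℝ → ℝ≥0∞ := fun r => U.indicator H (projIcc 0 1 zero_le_one r)
  have hf : Measurable f := (hH.indicator hU.measurableSet).comp continuous_projIcc.measurable
  have hfI : ∀ x : I, f x = U.indicator H x := fun x => by
    simp only [f, projIcc_val]
  have hset : ∀ B : Set ℝ, MeasurableSet B → B ⊆ Icc 0 1 →
      ∫⁻ r in B, f r = ∫⁻ x in ((↑) : I → ℝ) ⁻¹' B, U.indicator H x := by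
    intro B hB hBI
    have h := unitInterval.measurePreserving_coe.setLIntegral_comp_preimage hB hf
    rw [Measure.restrict_restrict hB, inter_eq_left.2 hBI] at h
    rw [← h]
    simp only [hfI]
  have hgfin : ∫⁻ r, (Icc (0 : ℝ) 1).indicator f r ≠ ⊤ := by
    rw [lintegral_indicator measurableSet_Icc, hset _ measurableSet_Icc subset_rfl]
    refine ne_top_of_le_ne_top hUfin ?_
    rw [← lintegral_indicator hU.measurableSet]
    exact setLIntegral_le_lintegral _ _
  have hae := (IsUnifLocDoublingMeasure.vitaliFamily (volume : Measure ℝ) 1).ae_tendsto_lintegral_div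
    (hf.indicator measurableSet_Icc).aemeasurable hgfin
  have hae' : ∀ᵐ x : I, Tendsto
      (fun a => (∫⁻ y in a, (Icc (0 : ℝ) 1).indicator f y) / volume a)
      ((IsUnifLocDoublingMeasure.vitaliFamily (volume : Measure ℝ) 1).filterAt (x : ℝ))
      (𝓝 ((Icc (0 : ℝ) 1).indicator f x)) :=
    unitInterval.measurePreserving_coe.quasiMeasurePreserving.ae (ae_restrict_of_ae hae)
  have h0 : ∀ᵐ x : I, x ≠ 0 := by simp [ae_iff, measure_singleton]
  filter_upwards [hae', h0] with x hx hx0 hxU hxM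
  have hx0' : 0 < x := pos_iff_ne_zero.2 hx0
  -- The centre of the interval containing x; its closed ball of radius 1/(2n) is the closure of
  -- that interval. For n = 0 the value is immaterial.
  have hchoice : ∀ n : ℕ, ∃ w : ℝ, 0 < n → ∃ i : Fin n, x ∈ vertexInterval n i ∧
      w = ((i : ℝ) + 1 / 2) / n := by
    intro n
    by_cases hn : 0 < n
    · obtain ⟨i, hi⟩ := exists_mem_vertexInterval hn hx0'
      exact ⟨_, fun _ => ⟨i, hi, rfl⟩⟩
    · exact ⟨0, fun h => absurd h hn⟩
  choose w hw using hchoice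
  have hball : ∀ n : ℕ, ∀ i : Fin n, w n = ((i : ℝ) + 1 / 2) / n →
      Metric.closedBall (w n) (1 / (2 * n)) = Icc ((i : ℝ) / n) (((i : ℝ) + 1) / n) := by
    intro n i hi
    have hn : (0 : ℝ) < n := by exact_mod_cast i.pos
    rw [Real.closedBall_eq_Icc, hi]
    congr 1 <;> field_simp <;> ring
  have hδ : Tendsto (fun n : ℕ => 1 / (2 * (n : ℝ))) atTop (𝓝[>] 0) := by
    refine tendsto_nhdsWithin_iff.2 ⟨?_, ?_⟩
    · simp only [one_div]
      exact tendsto_inv_atTop_zero.comp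
        (tendsto_natCast_atTop_atTop.const_mul_atTop (two_pos (α := ℝ)))
    · filter_upwards [eventually_gt_atTop 0] with n hn
      have hn : (0 : ℝ) < n := by exact_mod_cast hn
      simp only [mem_Ioi]
      positivity
  have hmem : ∀ᶠ n : ℕ in atTop, (x : ℝ) ∈ Metric.closedBall (w n) (1 * (1 / (2 * (n : ℝ)))) := by
    filter_upwards [eventually_gt_atTop 0] with n hn
    obtain ⟨i, hi, hwi⟩ := hw n hn
    rw [one_mul, hball n i hwi]
    exact ⟨hi.1.le, hi.2⟩
  have htend := IsUnifLocDoublingMeasure.tendsto_closedBall_filterAt (volume : Measure ℝ) w _ hδ hmem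
  have hlt := (hx.comp htend).eventually (gt_mem_nhds (show (Icc (0 : ℝ) 1).indicator f x < M by
    rw [indicator_of_mem x.2, hfI, indicator_of_mem hxU]; exact hxM))
  obtain ⟨V, hV, hVU⟩ := isOpen_induced_iff.1 hU
  have hVx : V ∈ 𝓝 (x : ℝ) := hV.mem_nhds (by rw [← hVU] at hxU; exact hxU)
  -- Since U is open, the intervals eventually lie in it, and there the cut-off function agrees with
  -- H.
  have hsub : ∀ᶠ n : ℕ in atTop, Metric.closedBall (w n) (1 / (2 * (n : ℝ))) ⊆ V :=
    htend.eventually (VitaliFamily.eventually_filterAt_subset_of_nhds _ hVx)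
  filter_upwards [eventually_gt_atTop 0, hlt, hsub] with n hn h1 h2
  obtain ⟨i, hi, hwi⟩ := hw n hn
  refine ⟨i, hi, ?_⟩
  have hn' : (0 : ℝ) < n := by exact_mod_cast hn
  have hi1 : (i : ℝ) + 1 ≤ n := by exact_mod_cast i.2
  simp only [Function.comp_apply] at h1
  rw [hball n i hwi] at h1 h2
  have hI : Icc ((i : ℝ) / n) (((i : ℝ) + 1) / n) ⊆ Icc 0 1 :=
    Icc_subset_Icc (by positivity) ((div_le_one hn').2 hi1)
  have hvol : volume (Icc ((i : ℝ) / n) (((i : ℝ) + 1) / n)) = ENNReal.ofReal (1 / n) := by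
    rw [Real.volume_Icc]
    congr 1
    field_simp
    ring
  have h3 : ∫⁻ y in Icc ((i : ℝ) / n) (((i : ℝ) + 1) / n), (Icc (0 : ℝ) 1).indicator f y =
      ∫⁻ y in ((↑) : I → ℝ) ⁻¹' Icc ((i : ℝ) / n) (((i : ℝ) + 1) / n), H y := by
    rw [setLIntegral_congr_fun measurableSet_Icc (fun y hy => indicator_of_mem (hI hy) f),
      hset _ measurableSet_Icc hI]
    refine setLIntegral_congr_fun (measurable_subtype_coe measurableSet_Icc) fun y hy => ?_
    exact indicator_of_mem (by rw [← hVU]; exact h2 hy) H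
  rw [h3, hvol] at h1
  have hpos : ENNReal.ofReal (1 / n) ≠ 0 := by
    simp only [ne_eq, ENNReal.ofReal_eq_zero, not_le]
    positivity
  rw [ENNReal.div_lt_iff (Or.inl hpos) (Or.inl ENNReal.ofReal_ne_top)] at h1
  refine le_trans (lintegral_mono_set ?_) h1.le
  exact fun y hy => ⟨hy.1.le, hy.2⟩

/-- Almost every point of {H < M} near a suitable x₀ eventually lies in low-degree intervals only.
Continuity of measure makes "eventually" uniform on a set of volume greater than δ. For large n the
low-degree intervals, each of length 1/n, cover that set, so there are at least δn of them. -/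
theorem exists_eventually_card_low_degree {H : I → ℝ≥0∞} (hH : Measurable H) {F : Set I}
    (hF : IsOpen F) (hF1 : volume F = 1) (hloc : LocallyIntegrableOn H F volume) {M : ℝ≥0∞}
    (hM : essInf H volume < M) :
    ∃ δ : ℝ, 0 < δ ∧ ∀ᶠ n : ℕ in atTop, ∃ L : Finset (Fin n), δ * n ≤ L.card ∧
      ∀ i ∈ L, ∫⁻ x in vertexInterval n i, H x ≤ M * ENNReal.ofReal (1 / n) := by
  classical
  have hA : volume {x | H x < M} ≠ 0 := by
    intro h0
    have : ∀ᵐ x, M ≤ H x := by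
      rw [ae_iff]
      simpa using h0
    exact absurd (le_essInf_of_ae_le M this) (not_le.2 hM)
  have hFae : ∀ᵐ x, x ∈ F := (mem_ae_iff_prob_eq_one hF.measurableSet).2 hF1
  have hAF : volume ({x | H x < M} ∩ F) ≠ 0 := by
    rwa [measure_inter_conull]
    exact hFae
  -- Local integrability gives finite integrals only near single points, so x₀ is chosen such that
  -- {H < M} has positive measure in each of its neighbourhoods.
  obtain ⟨x₀, hx₀, hpos⟩ := exists_mem_forall_mem_nhdsWithin_pos_measure hAF
  obtain ⟨s, hs, hint⟩ := hloc x₀ hx₀.2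
  rw [hF.nhdsWithin_eq hx₀.2] at hs
  obtain ⟨U, hUs, hU, hxU⟩ := mem_nhds_iff.1 hs
  have hUfin : ∫⁻ x in U, H x ≠ ⊤ := by
    have := (hint.mono_set hUs).2
    simpa [HasFiniteIntegral] using this.ne
  have hpos' : 0 < volume ({x | H x < M} ∩ U) := by
    refine lt_of_lt_of_le (hpos (({x | H x < M} ∩ F) ∩ U)
      (inter_mem self_mem_nhdsWithin (mem_nhdsWithin_of_mem_nhds (hU.mem_nhds hxU))))
      (measure_mono ?_)
    exact fun x hx => ⟨hx.1.1, hx.2⟩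
  let L : ∀ n : ℕ, Finset (Fin n) := fun n => Finset.univ.filter fun i =>
    ∫⁻ x in vertexInterval n i, H x ≤ M * ENNReal.ofReal (1 / n)
  set E : ℕ → Set I := fun m => ⋂ n ≥ m, vertexRegion n (L n) with hE
  have hmono : Monotone E := fun a b hab =>
    biInter_subset_biInter_left fun n (hn : b ≤ n) => hab.trans hn
  have hsub : volume ({x | H x < M} ∩ U) ≤ volume (⋃ m, E m) := by
    refine measure_mono_ae ?_
    filter_upwards [ae_eventually_lintegral_vertexInterval_le hH hU hUfin M] with x hx hxA
    obtain ⟨m, hm⟩ := eventually_atTop.1 (hx hxA.2 hxA.1)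
    refine mem_iUnion.2 ⟨m, mem_iInter₂.2 fun n hn => ?_⟩
    obtain ⟨i, hi, hle⟩ := hm n hn
    exact ⟨i, Finset.mem_filter.2 ⟨Finset.mem_univ _, hle⟩, hi⟩
  obtain ⟨δ, hδ, hδlt⟩ := ENNReal.lt_iff_exists_nnreal_btwn.1 (hpos'.trans_le hsub)
  have hev := (tendsto_measure_iUnion_atTop (μ := (volume : Measure I)) hmono).eventually
    (lt_mem_nhds hδlt)
  obtain ⟨m, hm⟩ := hev.exists
  refine ⟨δ, by simpa using hδ, ?_⟩
  filter_upwards [eventually_ge_atTop m, eventually_gt_atTop 0] with n hn hn0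
  refine ⟨L n, ?_, fun i hi => (Finset.mem_filter.1 hi).2⟩
  have h1 : (δ : ℝ≥0∞) ≤ volume (vertexRegion n (L n)) :=
    hm.le.trans (measure_mono (biInter_subset_of_mem hn))
  have h2 := ENNReal.toReal_mono (measure_ne_top _ _) h1
  rw [← measureReal_def, measureReal_vertexRegion, ENNReal.coe_toReal,
    le_div_iff₀ (by exact_mod_cast hn0)] at h2
  exact h2

/-! ### The second moment method -/

/-- Chebyshev's inequality for the number X of events that occur: (X - S)² equals S² wherever X = 0.
-/
theorem measureReal_forall_notMem_le {Ω ι : Type*} [MeasurableSpace Ω] {P : Measure Ω}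
    [IsProbabilityMeasure P] (L : Finset ι) {E : ι → Set Ω} (hE : ∀ i ∈ L, MeasurableSet (E i))
    {S K : ℝ} (hS : ∑ i ∈ L, P.real (E i) = S) (hS0 : 0 < S)
    (hK : ∑ i ∈ L, ∑ j ∈ L, P.real (E i ∩ E j) ≤ K) :
    P.real {ω | ∀ i ∈ L, ω ∉ E i} ≤ K / S ^ 2 - 1 := by
  set X : Ω → ℝ := fun ω => ∑ i ∈ L, (E i).indicator 1 ω with hX
  have hXX : ∀ ω, X ω ^ 2 = ∑ i ∈ L, ∑ j ∈ L, (E i ∩ E j).indicator (1 : Ω → ℝ) ω := by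
    intro ω
    rw [sq, hX, Finset.sum_mul_sum]
    refine Finset.sum_congr rfl fun i _ => Finset.sum_congr rfl fun j _ => ?_
    by_cases hi : ω ∈ E i <;> by_cases hj : ω ∈ E j <;> simp [hi, hj]
  have hint : ∀ s : Set Ω, MeasurableSet s → Integrable (s.indicator (1 : Ω → ℝ)) P :=
    fun s hs => (integrable_const (1 : ℝ)).indicator hs
  have hXint : Integrable X P := integrable_finsetSum _ fun i hi => hint _ (hE i hi)
  have hX2int : Integrable (fun ω => X ω ^ 2) P := by
    simp only [hXX]
    exact integrable_finsetSum _ fun i hi => integrable_finsetSum _ fun j hj =>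
      hint _ ((hE i hi).inter (hE j hj))
  have hEX : ∫ ω, X ω ∂P = S := by
    rw [hX, integral_finsetSum _ fun i hi => hint _ (hE i hi), ← hS]
    exact Finset.sum_congr rfl fun i hi => integral_indicator_one (hE i hi)
  have hEX2 : ∫ ω, X ω ^ 2 ∂P ≤ K := by
    refine le_trans (le_of_eq ?_) hK
    simp only [hXX]
    rw [integral_finsetSum _ fun i hi => integrable_finsetSum _ fun j hj =>
      hint _ ((hE i hi).inter (hE j hj))]
    refine Finset.sum_congr rfl fun i hi => ?_
    rw [integral_finsetSum _ fun j hj => hint _ ((hE i hi).inter (hE j hj))]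
    exact Finset.sum_congr rfl fun j hj => integral_indicator_one ((hE i hi).inter (hE j hj))
  have hD : MeasurableSet {ω | ∀ i ∈ L, ω ∉ E i} := by
    have : {ω | ∀ i ∈ L, ω ∉ E i} = ⋂ i ∈ L, (E i)ᶜ := by ext; simp
    rw [this]
    exact L.measurableSet_biInter fun i hi => (hE i hi).compl
  have hvar : ∫ ω, (X ω - S) ^ 2 ∂P = ∫ ω, X ω ^ 2 ∂P - S ^ 2 := by
    have h1 : ∀ ω, (X ω - S) ^ 2 = X ω ^ 2 - 2 * S * X ω + S ^ 2 := fun ω => by ring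
    have h2 : Integrable (fun ω => X ω ^ 2 - 2 * S * X ω) P := hX2int.sub (hXint.const_mul _)
    simp only [h1]
    rw [integral_add h2 (integrable_const _),
      integral_sub hX2int (hXint.const_mul _), integral_const_mul, hEX]
    simp
    ring
  have hle : S ^ 2 * P.real {ω | ∀ i ∈ L, ω ∉ E i} ≤ ∫ ω, (X ω - S) ^ 2 ∂P := by
    have hint' : Integrable (fun ω => (X ω - S) ^ 2) P := by
      have h1 : ∀ ω, (X ω - S) ^ 2 = X ω ^ 2 - 2 * S * X ω + S ^ 2 := fun ω => by ring
      simp only [h1]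
      exact (hX2int.sub (hXint.const_mul _)).add (integrable_const _)
    have h1 : ∫ ω, {ω | ∀ i ∈ L, ω ∉ E i}.indicator (fun _ => S ^ 2) ω ∂P =
        S ^ 2 * P.real {ω | ∀ i ∈ L, ω ∉ E i} := by
      rw [integral_indicator_const _ hD, smul_eq_mul, mul_comm]
    rw [← h1]
    refine integral_mono ((integrable_const _).indicator hD) hint' fun ω => ?_
    by_cases hω : ω ∈ {ω | ∀ i ∈ L, ω ∉ E i}
    · have : X ω = 0 := Finset.sum_eq_zero fun i hi => indicator_of_notMem (hω i hi) _
      simp only [indicator_of_mem hω, this]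
      exact le_of_eq (by ring)
    · simp only [indicator_of_notMem hω]
      positivity
  rw [hvar] at hle
  rw [le_sub_iff_add_le, le_div_iff₀ (by positivity)]
  linarith

/-- Pairs with w ≤ 1/ℓ are almost uncorrelated, with factor at most exp(2/ℓ). For the others 1 ≤ ℓw,
so Q i j ≤ p i is at most p i · ℓ w i j, which sums over j to p i · ℓ² at most. The diagonal
contributes the remaining p i. -/
theorem sum_sum_le_of_weakly_correlated {ι : Type*} (L : Finset ι) {p : ι → ℝ} {Q w : ι → ι → ℝ}
    {ℓ : ℝ} (hℓ : 0 < ℓ) (hp : ∀ i ∈ L, 0 ≤ p i) (hw : ∀ i ∈ L, ∀ j ∈ L, 0 ≤ w i j)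
    (hQ : ∀ i ∈ L, ∀ j ∈ L, Q i j ≤ p i)
    (hQ' : ∀ i ∈ L, ∀ j ∈ L, i ≠ j → Q i j ≤ p i * p j * Real.exp (2 * w i j))
    (hsum : ∀ i ∈ L, ∑ j ∈ L, w i j ≤ ℓ) :
    ∑ i ∈ L, ∑ j ∈ L, Q i j ≤
      (∑ i ∈ L, p i) * (1 + ℓ ^ 2) + (∑ i ∈ L, p i) ^ 2 * Real.exp (2 / ℓ) := by
  classical
  have hpt : ∀ i ∈ L, ∀ j ∈ L, Q i j ≤
      p i * p j * Real.exp (2 / ℓ) + p i * ((if i = j then 1 else 0) + ℓ * w i j) := by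
    intro i hi j hj
    have hpi := hp i hi
    have hpj := hp j hj
    have hwij := hw i hi j hj
    have h0 : 0 ≤ p i * p j * Real.exp (2 / ℓ) := by positivity
    by_cases hij : i = j
    · have h1 := hQ i hi j hj
      have h2 : 0 ≤ p i * (ℓ * w i j) := by positivity
      rw [if_pos hij]
      linarith
    · rw [if_neg hij, zero_add]
      by_cases hwl : w i j ≤ 1 / ℓ
      · have h1 := hQ' i hi j hj hij
        have h2 : p i * p j * Real.exp (2 * w i j) ≤ p i * p j * Real.exp (2 / ℓ) := by
          gcongr
          rw [show 2 / ℓ = 2 * (1 / ℓ) by ring]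
          gcongr
        have h3 : 0 ≤ p i * (ℓ * w i j) := by positivity
        linarith
      · have h1 := hQ i hi j hj
        have h2 : 1 ≤ ℓ * w i j := by
          rw [not_le, div_lt_iff₀ hℓ] at hwl
          linarith
        nlinarith
  calc ∑ i ∈ L, ∑ j ∈ L, Q i j
      ≤ ∑ i ∈ L, ∑ j ∈ L, (p i * p j * Real.exp (2 / ℓ) +
          p i * ((if i = j then 1 else 0) + ℓ * w i j)) :=
        Finset.sum_le_sum fun i hi => Finset.sum_le_sum fun j hj => hpt i hi j hj
    _ = (∑ i ∈ L, p i) ^ 2 * Real.exp (2 / ℓ) +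
          ∑ i ∈ L, p i * (1 + ℓ * ∑ j ∈ L, w i j) := by
        simp only [Finset.sum_add_distrib, ← Finset.mul_sum, ← Finset.sum_mul]
        rw [sq, Finset.sum_mul]
        congr 1
        refine Finset.sum_congr rfl fun i hi => ?_
        rw [Finset.sum_ite_eq, if_pos hi]
    _ ≤ (∑ i ∈ L, p i) ^ 2 * Real.exp (2 / ℓ) + ∑ i ∈ L, p i * (1 + ℓ ^ 2) := by
        gcongr with i hi
        · exact hp i hi
        · rw [sq]
          exact mul_le_mul_of_nonneg_left (hsum i hi) hℓ.le
    _ = _ := by rw [← Finset.sum_mul]; ring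

/-! ### Isolated vertices below the threshold -/

theorem mem_vertexRegion_singleton {n : ℕ} {i : Fin n} {x : I} :
    x ∈ vertexRegion n {i} ↔ x ∈ vertexInterval n i := by
  simp [vertexRegion]

/-- Only one of the two cells lies above the diagonal. Keeping both avoids a case distinction and
costs only a factor 2 in the correlation exponent. -/
theorem crossingRegion_inter_subset {n : ℕ} {i j : Fin n} (hij : i ≠ j) :
    crossingRegion n {i} ∩ crossingRegion n {j} ⊆
      (vertexInterval n i ×ˢ vertexInterval n j) ∪
        Prod.swap ⁻¹' (vertexInterval n i ×ˢ vertexInterval n j) := by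
  rintro p ⟨⟨-, hi⟩, ⟨-, hj⟩⟩
  rcases hi with ⟨h1, h2⟩ | ⟨h1, h2⟩ <;> rcases hj with ⟨h3, h4⟩ | ⟨h3, h4⟩
  · exact absurd (eq_of_mem_vertexInterval (mem_vertexRegion_singleton.1 h1)
      (mem_vertexRegion_singleton.1 h3)) hij
  · exact Or.inl ⟨mem_vertexRegion_singleton.1 h1, mem_vertexRegion_singleton.1 h4⟩
  · exact Or.inr ⟨mem_vertexRegion_singleton.1 h2, mem_vertexRegion_singleton.1 h3⟩
  · exact absurd (eq_of_mem_vertexInterval (mem_vertexRegion_singleton.1 h2)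
      (mem_vertexRegion_singleton.1 h4)) hij

theorem sum_kernelMass_vertexInterval_le (W : I → I → ℝ≥0) {n : ℕ} (i : Fin n)
    (L : Finset (Fin n)) :
    ∑ j ∈ L, kernelMass W (vertexInterval n i ×ˢ vertexInterval n j) ≤
      kernelMass W (vertexInterval n i ×ˢ univ) := by
  rw [← measure_biUnion_finset]
  · exact measure_mono (iUnion₂_subset fun j _ => prod_mono_right (subset_univ _))
  · intro j _ k _ hjk
    exact Set.disjoint_left.2 fun p hp hp' => hjk (eq_of_mem_vertexInterval hp.2 hp'.2)
  · exact fun j _ => (measurableSet_vertexInterval n i).prod (measurableSet_vertexInterval n j)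

/-- Both vertices are isolated when the union of the crossing regions is void. By
inclusion–exclusion its mass falls short of the sum of the two masses by that of the intersection,
at most twice the mass of one cell. -/
theorem measureReal_isolated_inter_le {W : I → I → ℝ≥0} (hW : Measurable (Function.uncurry W))
    (hW_symm : ∀ x y, W x y = W y x) {t : ℝ} (ht : 0 ≤ t) {n : ℕ}
    {Ω : Type*} [MeasurableSpace Ω] {P : Measure Ω} {N : Ω → Measure (I × I)}
    (hN : IsPoissonPointProcess N (kernelIntensity t W) P) {i j : Fin n} (hij : i ≠ j)
    (hi : kernelMass W (crossingRegion n {i}) ≠ ⊤) (hj : kernelMass W (crossingRegion n {j}) ≠ ⊤)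
    (hw : kernelMass W (vertexInterval n i ×ˢ vertexInterval n j) ≠ ⊤) :
    P.real ({ω | N ω (crossingRegion n {i}) = 0} ∩ {ω | N ω (crossingRegion n {j}) = 0}) ≤
      P.real {ω | N ω (crossingRegion n {i}) = 0} * P.real {ω | N ω (crossingRegion n {j}) = 0} *
        Real.exp (2 * (t * (kernelMass W).real (vertexInterval n i ×ˢ vertexInterval n j))) := by
  have hvoid : ∀ B : Set (I × I), MeasurableSet B → kernelMass W B ≠ ⊤ →
      P.real {ω | N ω B = 0} = Real.exp (-(t * (kernelMass W).real B)) := by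
    intro B hB hfin
    rw [measureReal_def, hN.measure_eq_zero hB (by
      rw [kernelIntensity_apply _ hW]; exact ENNReal.mul_ne_top ENNReal.ofReal_ne_top hfin),
      ENNReal.toReal_ofReal (Real.exp_pos _).le, kernelIntensity_apply _ hW, ENNReal.toReal_mul,
      ENNReal.toReal_ofReal ht, measureReal_def]
  have hBi := measurableSet_crossingRegion n {i}
  have hBj := measurableSet_crossingRegion n {j}
  have hunion : {ω | N ω (crossingRegion n {i}) = 0} ∩ {ω | N ω (crossingRegion n {j}) = 0} =
      {ω | N ω (crossingRegion n {i} ∪ crossingRegion n {j}) = 0} := by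
    ext ω
    simp [measure_union_null_iff]
  have hS : MeasurableSet (vertexInterval n i ×ˢ vertexInterval n j) :=
    (measurableSet_vertexInterval n i).prod (measurableSet_vertexInterval n j)
  have hinter : (kernelMass W).real (crossingRegion n {i} ∩ crossingRegion n {j}) ≤
      2 * (kernelMass W).real (vertexInterval n i ×ˢ vertexInterval n j) := by
    have h1 : kernelMass W (crossingRegion n {i} ∩ crossingRegion n {j}) ≤
        2 * kernelMass W (vertexInterval n i ×ˢ vertexInterval n j) := by
      refine (measure_mono (crossingRegion_inter_subset hij)).trans ?_
      refine (measure_union_le _ _).trans (le_of_eq ?_)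
      rw [kernelMass_preimage_swap hW_symm hS, two_mul]
    have h2 := ENNReal.toReal_mono (ENNReal.mul_ne_top (by simp) hw) h1
    simpa [ENNReal.toReal_mul, measureReal_def] using h2
  have hadd : (kernelMass W).real (crossingRegion n {i} ∪ crossingRegion n {j}) +
      (kernelMass W).real (crossingRegion n {i} ∩ crossingRegion n {j}) =
      (kernelMass W).real (crossingRegion n {i}) + (kernelMass W).real (crossingRegion n {j}) :=
    measureReal_union_add_inter hBj hi hj
  rw [hunion, hvoid _ (hBi.union hBj) (measure_union_ne_top hi hj), hvoid _ hBi hi,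
    hvoid _ hBj hj, ← Real.exp_add, ← Real.exp_add, Real.exp_le_exp]
  nlinarith

theorem measureReal_connected_le {W : I → I → ℝ≥0} (hW : Measurable (Function.uncurry W))
    (hW_symm : ∀ x y, W x y = W y x) {c M δ : ℝ} (hc : 0 ≤ c) (hM : 0 ≤ M) (hcM : c * M ≤ 1)
    (hδ : 0 < δ) {n : ℕ} (hn : 2 ≤ n) {Ω : Type*} [MeasurableSpace Ω] {P : Measure Ω}
    [IsProbabilityMeasure P] {N : Ω → Measure (I × I)}
    (hN : IsPoissonPointProcess N (kernelIntensity (c * n * Real.log n) W) P)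
    {L : Finset (Fin n)} (hL : δ * n ≤ L.card)
    (hdeg : ∀ i ∈ L, ∫⁻ x in vertexInterval n i, kernelDegree W x ≤
      ENNReal.ofReal M * ENNReal.ofReal (1 / n)) :
    P.real {ω | MultigraphConnected (pointMultigraph n (N ω))} ≤
      (1 + Real.log n ^ 2) / (δ * Real.exp ((1 - c * M) * Real.log n)) +
        Real.exp (2 / Real.log n) - 1 := by
  have hn0 : (0 : ℝ) < n := by positivity
  have hℓ : 0 < Real.log n := Real.log_pos (by exact_mod_cast hn)
  set ℓ := Real.log n with hℓdef
  set t := c * n * ℓ with ht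
  have ht0 : 0 ≤ t := by positivity
  have hrow : ∀ i ∈ L, kernelMass W (vertexInterval n i ×ˢ univ) ≤ ENNReal.ofReal (M / n) := by
    intro i hi
    rw [kernelMass_prod_univ hW (measurableSet_vertexInterval n i), div_eq_mul_one_div,
      ENNReal.ofReal_mul hM]
    exact hdeg i hi
  have hcross : ∀ i ∈ L, kernelMass W (crossingRegion n {i}) ≤ ENNReal.ofReal (M / n) := by
    intro i hi
    rw [kernelMass_crossingRegion hW_symm]
    refine le_trans (measure_mono ?_) (hrow i hi)
    exact fun p hp => ⟨mem_vertexRegion_singleton.1 hp.1, mem_univ _⟩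
  have hcell : ∀ i ∈ L, ∀ j, kernelMass W (vertexInterval n i ×ˢ vertexInterval n j) ≠ ⊤ :=
    fun i hi j => ne_top_of_le_ne_top ENNReal.ofReal_ne_top
      ((measure_mono (prod_mono_right (subset_univ _))).trans (hrow i hi))
  have hcross' : ∀ i ∈ L, kernelMass W (crossingRegion n {i}) ≠ ⊤ := fun i hi =>
    ne_top_of_le_ne_top ENNReal.ofReal_ne_top (hcross i hi)
  have htM : t * (M / n) = c * M * ℓ := by
    rw [ht]; field_simp
  let E : Fin n → Set Ω := fun i => {ω | N ω (crossingRegion n {i}) = 0}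
  let w : Fin n → Fin n → ℝ := fun i j =>
    t * (kernelMass W).real (vertexInterval n i ×ˢ vertexInterval n j)
  have hEm : ∀ i, MeasurableSet (E i) := fun i =>
    hN.measurableSet_eq_zero (measurableSet_crossingRegion n {i})
  have hp : ∀ i ∈ L, Real.exp (-(c * M * ℓ)) ≤ P.real (E i) := by
    intro i hi
    have h1 : kernelIntensity t W (crossingRegion n {i}) ≠ ⊤ := by
      rw [kernelIntensity_apply _ hW]
      exact ENNReal.mul_ne_top ENNReal.ofReal_ne_top (hcross' i hi)
    have h2 : (kernelMass W (crossingRegion n {i})).toReal ≤ M / n :=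
      ENNReal.toReal_le_of_le_ofReal (by positivity) (hcross i hi)
    rw [measureReal_def, hN.measure_eq_zero (measurableSet_crossingRegion n {i}) h1,
      ENNReal.toReal_ofReal (Real.exp_pos _).le, Real.exp_le_exp, kernelIntensity_apply _ hW,
      ENNReal.toReal_mul, ENNReal.toReal_ofReal ht0, ← htM]
    gcongr
  -- The cells of row i share its degree mass M/n, so their total intensity is at most cMℓ, and cM ≤
  -- 1.
  have hwsum : ∀ i ∈ L, ∑ j ∈ L, w i j ≤ ℓ := by
    intro i hi
    have h1 : ∑ j ∈ L, (kernelMass W).real (vertexInterval n i ×ˢ vertexInterval n j) ≤ M / n := by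
      simp only [measureReal_def]
      rw [← ENNReal.toReal_sum fun j _ => hcell i hi j]
      exact ENNReal.toReal_le_of_le_ofReal (by positivity)
        ((sum_kernelMass_vertexInterval_le W i L).trans (hrow i hi))
    calc ∑ j ∈ L, w i j
        = t * ∑ j ∈ L, (kernelMass W).real (vertexInterval n i ×ˢ vertexInterval n j) := by
          rw [Finset.mul_sum]
      _ ≤ t * (M / n) := by gcongr
      _ = c * M * ℓ := htM
      _ ≤ ℓ := by nlinarith
  set S := ∑ i ∈ L, P.real (E i) with hS
  -- At least δn vertices are each isolated with probability at least n^{-cM}.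
  have hSge : δ * Real.exp ((1 - c * M) * ℓ) ≤ S := by
    have h1 : L.card * Real.exp (-(c * M * ℓ)) ≤ S := by
      rw [hS, ← nsmul_eq_mul]
      exact Finset.card_nsmul_le_sum _ _ _ hp
    refine le_trans ?_ h1
    have h2 : Real.exp ((1 - c * M) * ℓ) = n * Real.exp (-(c * M * ℓ)) := by
      conv_rhs => rw [← Real.exp_log hn0]
      rw [← Real.exp_add, ← hℓdef]
      congr 1; ring
    rw [h2, ← mul_assoc]
    gcongr
  have hS0 : 0 < S := lt_of_lt_of_le (by positivity) hSge
  have hK := sum_sum_le_of_weakly_correlated L (p := fun i => P.real (E i))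
    (Q := fun i j => P.real (E i ∩ E j)) (w := w) hℓ (fun i _ => measureReal_nonneg)
    (fun i _ j _ => mul_nonneg ht0 measureReal_nonneg)
    (fun i _ j _ => measureReal_mono inter_subset_left)
    (fun i hi j hj hij => measureReal_isolated_inter_le hW hW_symm ht0 hN hij (hcross' i hi)
      (hcross' j hj) (hcell i hi j)) hwsum
  have hmain := measureReal_forall_notMem_le L (fun i _ => hEm i) hS.symm hS0 hK
  have hsub : {ω | MultigraphConnected (pointMultigraph n (N ω))} ⊆ {ω | ∀ i ∈ L, ω ∉ E i} :=
    fun ω hω i _ hi => not_multigraphConnected_of_crossingRegion hn hi hω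
  refine (measureReal_mono hsub).trans (hmain.trans ?_)
  have h3 : (S * (1 + ℓ ^ 2) + S ^ 2 * Real.exp (2 / ℓ)) / S ^ 2 =
      (1 + ℓ ^ 2) / S + Real.exp (2 / ℓ) := by
    field_simp
  change (S * (1 + ℓ ^ 2) + S ^ 2 * Real.exp (2 / ℓ)) / S ^ 2 - 1 ≤ _
  rw [h3]
  gcongr

theorem tendsto_second_moment_bound {a δ : ℝ} (ha : 0 < a) :
    Tendsto (fun ℓ : ℝ => (1 + ℓ ^ 2) / (δ * Real.exp (a * ℓ)) + Real.exp (2 / ℓ) - 1)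
      atTop (𝓝 0) := by
  have h1 : Tendsto (fun ℓ : ℝ => ℓ ^ 2 * Real.exp (-(a * ℓ))) atTop (𝓝 0) := by
    have h := Real.tendsto_pow_mul_exp_neg_atTop_nhds_zero 2
    have h' := (h.comp (tendsto_id.const_mul_atTop ha)).const_mul (1 / a ^ 2)
    rw [mul_zero] at h'
    refine h'.congr fun ℓ => ?_
    simp only [Function.comp_apply, id]
    field_simp
  have h2 : Tendsto (fun ℓ : ℝ => Real.exp (-(a * ℓ))) atTop (𝓝 0) :=
    Real.tendsto_exp_neg_atTop_nhds_zero.comp (tendsto_id.const_mul_atTop ha)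
  have h3 : Tendsto (fun ℓ : ℝ => Real.exp (2 / ℓ)) atTop (𝓝 1) := by
    have := (Real.continuous_exp.tendsto 0).comp
      ((tendsto_const_nhds (x := (2 : ℝ))).div_atTop tendsto_id)
    rwa [Real.exp_zero] at this
  have h4 := (((h2.add h1).const_mul (1 / δ)).add h3).sub_const 1
  rw [add_zero, mul_zero, zero_add, sub_self] at h4
  refine h4.congr fun ℓ => ?_
  rw [Real.exp_neg]
  congr 2
  rw [div_mul_eq_div_div, div_eq_mul_inv _ (Real.exp _)]
  ring

theorem tendsto_measure_connected_zero {W : I → I → ℝ≥0}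
    (hW : Measurable (Function.uncurry W)) (hW_symm : ∀ x y, W x y = W y x)
    {c : ℝ≥0} {Ω : ℕ → Type*} [∀ n, MeasurableSpace (Ω n)]
    {P : ∀ n, Measure (Ω n)} [∀ n, IsProbabilityMeasure (P n)] {N : ∀ n, Ω n → Measure (I × I)}
    (hN : ∀ n, 2 ≤ n →
      IsPoissonPointProcess (N n) (kernelIntensity ((c : ℝ) * n * Real.log n) W) (P n))
    (hc : (c : ℝ≥0∞) < 1 / kernelMinDegree W) {F : Set I} (hF : IsOpen F) (hF1 : volume F = 1)
    (hloc : LocallyIntegrableOn (kernelDegree W) F volume) :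
    Tendsto (fun n => P n {ω | MultigraphConnected (pointMultigraph n (N n ω))})
      atTop (𝓝 0) := by
  -- If ν₀ = ∞, then 1/ν₀ = 0 and no c lies below it.
  have hνtop : kernelMinDegree W ≠ ⊤ := by
    intro h
    rw [h] at hc
    simp at hc
  set ν := (kernelMinDegree W).toReal with hν
  have hν0 : 0 ≤ ν := ENNReal.toReal_nonneg
  have hcν : c * ν < 1 := by
    have h1 : (c : ℝ≥0∞) * kernelMinDegree W < 1 := by
      exact (ENNReal.lt_div_iff_mul_lt (Or.inr ENNReal.coe_ne_top) (Or.inl hνtop)).1 hc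
    have h2 := ENNReal.toReal_strict_mono ENNReal.one_ne_top h1
    simpa [ENNReal.toReal_mul] using h2
  have hc0 : (0 : ℝ) ≤ c := c.2
  -- A number M > ν with cM < 1; the denominator c + 1 keeps the choice valid for c = 0.
  set M := ν + (1 - c * ν) / (c + 1) with hM
  have hνM : ν < M := by
    have : 0 < (1 - c * ν) / (c + 1) := div_pos (by linarith) (by linarith)
    linarith
  have hcM : c * M < 1 := by
    have h1 : c * M = c * ν + c * (1 - c * ν) / (c + 1) := by rw [hM]; ring
    have h2 : c * (1 - c * ν) / (c + 1) < 1 - c * ν := by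
      rw [div_lt_iff₀ (by linarith)]
      nlinarith
    linarith
  have hess : essInf (kernelDegree W) volume < ENNReal.ofReal M :=
    (ENNReal.lt_ofReal_iff_toReal_lt hνtop).2 hνM
  obtain ⟨δ, hδ, hev⟩ := exists_eventually_card_low_degree (measurable_kernelDegree hW) hF hF1
    hloc hess
  have hlog : Tendsto (fun n : ℕ => Real.log n) atTop atTop :=
    Real.tendsto_log_atTop.comp tendsto_natCast_atTop_atTop
  have hlim := ENNReal.tendsto_ofReal
    ((tendsto_second_moment_bound (δ := δ) (show 0 < 1 - c * M by linarith)).comp hlog)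
  rw [ENNReal.ofReal_zero] at hlim
  refine tendsto_of_tendsto_of_tendsto_of_le_of_le' tendsto_const_nhds hlim
    (Eventually.of_forall fun n => zero_le) ?_
  filter_upwards [hev, eventually_ge_atTop 2] with n hLn hn
  obtain ⟨L, hL, hdeg⟩ := hLn
  have h := measureReal_connected_le hW hW_symm hc0 (hν0.trans hνM.le) hcM.le hδ hn (hN n hn)
    hL hdeg
  rw [← ofReal_measureReal]
  exact ENNReal.ofReal_le_ofReal h

theorem theorem1
    (W : I → I → ℝ≥0)
    (hW_meas : Measurable (Function.uncurry W))
    (hW_symm : ∀ x y, W x y = W y x)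
    (hW_irr : KernelIrreducible W)
    (c : ℝ≥0)
    {Ω : ℕ → Type*} [∀ n, MeasurableSpace (Ω n)]
    (P : ∀ n, Measure (Ω n)) [∀ n, IsProbabilityMeasure (P n)]
    (N : ∀ n, Ω n → Measure (I × I))
    (hN : ∀ n, 2 ≤ n →
      IsPoissonPointProcess (N n) (kernelIntensity ((c : ℝ) * n * Real.log n) W) (P n)) :
    ((c : ℝ≥0∞) < 1 / kernelMinDegree W →
      (∃ F : Set I, IsOpen F ∧ volume F = 1 ∧ LocallyIntegrableOn (kernelDegree W) F volume) →
      Tendsto (fun n => P n {ω | MultigraphConnected (pointMultigraph n (N n ω))})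
        atTop (𝓝 0)) ∧
    (1 / kernelMinDegree W < (c : ℝ≥0∞) →
      (∃ q : ℝ≥0∞, 2 < q ∧ MemLp (fun p : I × I => (W p.1 p.2 : ℝ)) q volume) →
      Tendsto (fun n => P n {ω | MultigraphConnected (pointMultigraph n (N n ω))})
        atTop (𝓝 1)) := by
  refine ⟨fun hc hF => ?_, fun hc hq => ?_⟩
  · obtain ⟨F, hF, hF1, hloc⟩ := hF
    exact tendsto_measure_connected_zero hW_meas hW_symm hN hc hF hF1 hloc
  · obtain ⟨q, hq, hWq⟩ := hq
    exact tendsto_measure_connected_one hW_meas hW_symm hW_irr hN hc hq hWq
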